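/- Let $m\ge 2$ and let $T=(\mathcal V,\mathcal E)$ be the homogeneous tree in which every vertex has exactly $m+1$ neighbours, with graph distance $d$. Fix a doubly-infinite geodesic $g_0\subset\mathcal V$ and a map $N:g_0\to\mathbb Z$ with $|N(x)-N(y)|=d(x,y)$ for all $x,y\in g_0$. The level of a vertex $x$ is $\ell(x)=N(x')-d(x,x')$, where $x'$ is the vertex of $g_0$ nearest to $x$; $x$ lies below $y$ if $\ell(x)=\ell(y)-d(x,y)$; and $\mu$ is the measure on $\mathcal V$ with $\int f\,d\mu=\sum_{x\in\mathcal V} f(x)\,m^{\ell(x)}$. A Calderón–Zygmund set is either a singleton or a set $\{x: x \text{ lies below } r,\ h/2\le \ell(r)-\ell(x)<4h\}$ with $r\in\mathcal V$ and $h$ a positive integer. For $p\in(1,\infty]$, a $(1,p)$-atom is a function $a:\mathcal V\to\mathbb C$ supported in a Calderón–Zygmund set $R$ with $\|a\|_{L^p(\mu)}\le\mu(R)^{1/p-1}$ and $\int a\,d\mu=0$. $H^{1,p}(\mu)$ is the space of all $g\in L^1(\mu)$ of the form $g=\sum_{j}\lambda_ja_j$ (convergence in $L^1(\mu)$) with $(1,p)$-atoms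 $a_j$ and $\sum_j|\lambda_j|<\infty$, and $\|g\|_{H^{1,p}}$ is the infimum of $\sum_j|\lambda_j|$ over all such decompositions. Put $H^1(\mu)=H^{1,\infty}(\mu)$, and let $H^{1,\infty}_{\mathrm{fin}}(\mu)$ be the space of finite linear combinations of $(1,\infty)$-atoms. $BMO_1(\mu)$ is the space, modulo constants, of the locally integrable functions $f:\mathcal V\to\mathbb C$ with $$\|f\|_{BMO_1}=\sup_R\frac1{\mu(R)}\int_R|f-f_R|\,d\mu<\infty,\qquad f_R=\frac1{\mu(R)}\int_R f\,d\mu,$$ the supremum being over all Calderón–Zygmund sets $R$. Then the following hold. (i) There is a constant $A>0$ such that for every $f\in BMO_1(\mu)$ there is a unique bounded linear functional $L_f$ on $H^1(\mu)$ with $L_f(g)=\int fg\,d\mu$ for all $g\in H^{1,\infty}_{\mathrm{fin}}(\mu)$, and $\|L_f\|_{(H^1)^*}\le A\,\|f\|_{BMO_1}$. (ii) There is a constant $C_2>0$ such that $$H^{1,2}(\mu)=H^{1,\infty}(\mu)\quad\text{and}\quad \|g\|_{H^{1,2}}\le\|g\|_{H^{1,\infty}}\le C_2\|g\|_{H^{1,2}}\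 \text{ for all } g\in H^{1,2}(\mu),$$ and, for every such constant $C_2$ and every bounded linear functional $L$ on $H^1(\mu)$, there is a unique $f\in BMO_1(\mu)$ with $L=L_f$, and it satisfies $\|f\|_{BMO_1}\le C_2\,\|L\|_{(H^1)^*}$. -/

import Mathlib

set_option linter.unusedSectionVars false

open MeasureTheory Filter Topology
open scoped ENNReal

noncomputable section

/-- A homogeneous tree of order `m + 1` (with `m ≥ 2`) on the vertex set `V`, together with a fixed
doubly-infinite geodesic `geod` and a numeration `N` of it, that is an isometric labelling of the
vertices of `geod` by integers (a choice of origin and orientation). -/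
structure WeightedTree (V : Type*) (m : ℕ) where
  two_le : 2 ≤ m
  graph : SimpleGraph V
  isTree : graph.IsTree
  regular : ∀ v : V, (graph.neighborSet v).ncard = m + 1
  geod : Set V
  geod_connected : (graph.induce geod).Connected
  geod_two : ∀ v ∈ geod, (graph.neighborSet v ∩ geod).ncard = 2
  geod_convex : ∀ u ∈ geod, ∀ v ∈ geod, ∀ p : graph.Walk u v, p.length = graph.dist u v →
    ∀ w ∈ p.support, w ∈ geod
  N : geod → ℤ
  N_isometry : ∀ x y : geod, |N x - N y| = (graph.dist (x : V) (y : V) : ℤ)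

namespace WeightedTree

variable {V : Type*} {m : ℕ} (T : WeightedTree V m)

instance instNonemptyGeod : Nonempty T.geod := T.geod_connected.nonempty

/-- The vertex of the geodesic that is nearest to `x`. -/
def proj (x : V) : T.geod := Function.argmin (fun z : T.geod => T.graph.dist x (z : V))

/-- The level function `ℓ(x) = N(x') - d(x, x')`, with `x'` the point of the geodesic nearest
to `x`. -/
def level (x : V) : ℤ := T.N (T.proj x) - (T.graph.dist x (T.proj x : V) : ℤ)

/-- `x` lies below `y`. -/
def LiesBelow (x y : V) : Prop := T.level x = T.level y - (T.graph.dist x y : ℤ)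

/-- The trapezoid with root node `r` and parameters `a, b`. -/
def trapezoid (r : V) (a b : ℝ) : Set V :=
  {x | T.LiesBelow x r ∧ a ≤ ((T.level r - T.level x : ℤ) : ℝ) ∧
    ((T.level r - T.level x : ℤ) : ℝ) < b}

/-- Calderón–Zygmund sets: singletons (degenerate case), and the envelopes
`h/2 ≤ ℓ(r) - ℓ(x) < 4h` of the admissible trapezoids `h ≤ ℓ(r) - ℓ(x) < 2h`, with `h` a positive
integer. -/
def IsCZ (R : Set V) : Prop :=
  (∃ r : V, R = {r}) ∨ ∃ (r : V) (h : ℕ), 0 < h ∧ R = T.trapezoid r ((h : ℝ) / 2) (4 * h)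

variable [MeasurableSpace V]

/-- The weighted counting measure giving the vertex `x` the mass `m ^ ℓ(x)`. -/
def μ : Measure V :=
  Measure.sum fun x : V => ENNReal.ofReal ((m : ℝ) ^ T.level x) • Measure.dirac x

/-- `(1, p)`-atoms. For `p = ∞`, `(p⁻¹).toReal = 0`. -/
def IsAtom (p : ℝ≥0∞) (a : V → ℂ) : Prop :=
  ∃ R : Set V, T.IsCZ R ∧ (∀ x, x ∉ R → a x = 0) ∧
    eLpNorm a p T.μ ≤ T.μ R ^ ((p⁻¹).toReal - 1) ∧ ∫ x, a x ∂T.μ = 0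

/-- `g = ∑ j, c j • a j` in `L¹(μ)` with `(1, p)`-atoms `a j` and absolutely summable
coefficients. -/
structure IsDecomp (p : ℝ≥0∞) (g : V → ℂ) (c : ℕ → ℂ) (a : ℕ → V → ℂ) : Prop where
  atom : ∀ j, T.IsAtom p (a j)
  summable : Summable fun j => ‖c j‖
  tendsto : Tendsto
    (fun n : ℕ => eLpNorm (fun x => g x - ∑ j ∈ Finset.range n, c j * a j x) 1 T.μ) atTop (𝓝 0)

/-- The norm of `H^{1,p}(μ)`. -/
def hardyNorm (p : ℝ≥0∞) (g : V → ℂ) : ℝ :=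
  sInf {s : ℝ | ∃ (c : ℕ → ℂ) (a : ℕ → V → ℂ), T.IsDecomp p g c a ∧ s = ∑' j, ‖c j‖}

variable {T}

lemma hardyNorm_nonneg (p : ℝ≥0∞) (g : V → ℂ) : 0 ≤ T.hardyNorm p g := by
  apply Real.sInf_nonneg
  rintro s ⟨c, a, -, rfl⟩
  exact tsum_nonneg fun _ => norm_nonneg _

lemma IsDecomp.hardyNorm_le {p : ℝ≥0∞} {g : V → ℂ} {c : ℕ → ℂ} {a : ℕ → V → ℂ}
    (h : T.IsDecomp p g c a) : T.hardyNorm p g ≤ ∑' j, ‖c j‖ := by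
  refine csInf_le ⟨0, ?_⟩ ⟨c, a, h, rfl⟩
  rintro s ⟨c, a, -, rfl⟩
  exact tsum_nonneg fun _ => norm_nonneg _

lemma exists_isDecomp_lt {p : ℝ≥0∞} {g : V → ℂ} (h : ∃ c a, T.IsDecomp p g c a) {ε : ℝ}
    (hε : 0 < ε) : ∃ c a, T.IsDecomp p g c a ∧ ∑' j, ‖c j‖ < T.hardyNorm p g + ε := by
  obtain ⟨c, a, hca⟩ := h
  obtain ⟨s, ⟨c, a, hca, rfl⟩, hlt⟩ := exists_lt_of_csInf_lt
    (s := {s : ℝ | ∃ (c : ℕ → ℂ) (a : ℕ → V → ℂ), T.IsDecomp p g c a ∧ s = ∑' j, ‖c j‖})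
    ⟨_, c, a, hca, rfl⟩ (b := T.hardyNorm p g + ε) (by
      change T.hardyNorm p g < _
      linarith)
  exact ⟨c, a, hca, hlt⟩

lemma IsDecomp.smul {p : ℝ≥0∞} {g : V → ℂ} {c : ℕ → ℂ} {a : ℕ → V → ℂ}
    (h : T.IsDecomp p g c a) (k : ℂ) : T.IsDecomp p (k • g) (fun j => k * c j) a := by
  refine ⟨h.atom, by simpa only [norm_mul] using h.summable.mul_left ‖k‖, ?_⟩
  have h1 := ENNReal.Tendsto.const_mul (a := ‖k‖ₑ) h.tendsto (Or.inr enorm_ne_top)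
  rw [mul_zero] at h1
  refine h1.congr fun n => ?_
  rw [← eLpNorm_const_smul]
  congr 1
  ext x
  simp [mul_sub, Finset.mul_sum, mul_assoc]

lemma sum_range_interleave (u v : ℕ → ℂ) (n : ℕ) :
    ∑ j ∈ Finset.range n, (if j % 2 = 0 then u (j / 2) else v (j / 2)) =
      ∑ j ∈ Finset.range ((n + 1) / 2), u j + ∑ j ∈ Finset.range (n / 2), v j := by
  induction n with
  | zero => simp
  | succ n ih =>
    rw [Finset.sum_range_succ, ih]
    rcases Nat.even_or_odd' n with ⟨k, rfl | rfl⟩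
    · have h1 : (2 * k + 1 + 1) / 2 = k + 1 := by omega
      have h2 : (2 * k + 1) / 2 = k := by omega
      have h3 : 2 * k / 2 = k := by omega
      have h4 : 2 * k % 2 = 0 := by omega
      rw [h1, h2, h3, if_pos h4, Finset.sum_range_succ]
      ring
    · have h1 : (2 * k + 1 + 1 + 1) / 2 = k + 1 := by omega
      have h2 : (2 * k + 1 + 1) / 2 = k + 1 := by omega
      have h3 : (2 * k + 1) / 2 = k := by omega
      have h4 : ¬ (2 * k + 1) % 2 = 0 := by omega
      rw [h1, h2, h3, if_neg h4, Finset.sum_range_succ (f := v)]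
      ring

lemma hasSum_interleave {u v : ℕ → ℝ} (hu : Summable u) (hv : Summable v) :
    HasSum (fun j => if j % 2 = 0 then u (j / 2) else v (j / 2)) (∑' j, u j + ∑' j, v j) := by
  apply HasSum.even_add_odd
  · have : (fun k => if 2 * k % 2 = 0 then u (2 * k / 2) else v (2 * k / 2)) = u := by
      ext k
      rw [if_pos (by omega), show 2 * k / 2 = k by omega]
    rw [this]
    exact hu.hasSum
  · have : (fun k => if (2 * k + 1) % 2 = 0 then u ((2 * k + 1) / 2)
        else v ((2 * k + 1) / 2)) = v := by
      ext k
      rw [if_neg (by omega), show (2 * k + 1) / 2 = k by omega]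
    rw [this]
    exact hv.hasSum

variable [DiscreteMeasurableSpace V]

lemma aesm (ν : Measure V) (f : V → ℂ) : AEStronglyMeasurable f ν :=
  (Measurable.of_discrete (f := f)).aestronglyMeasurable

lemma IsDecomp.add {p : ℝ≥0∞} {g g' : V → ℂ} {c c' : ℕ → ℂ} {a a' : ℕ → V → ℂ}
    (h : T.IsDecomp p g c a) (h' : T.IsDecomp p g' c' a') :
    ∃ d b, T.IsDecomp p (g + g') d b ∧ ∑' j, ‖d j‖ = ∑' j, ‖c j‖ + ∑' j, ‖c' j‖ := by
  have hs := hasSum_interleave h.summable h'.summable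
  have hn : (fun j : ℕ => ‖(if j % 2 = 0 then c (j / 2) else c' (j / 2))‖) =
      fun j => if j % 2 = 0 then ‖c (j / 2)‖ else ‖c' (j / 2)‖ := by
    ext j
    split_ifs <;> rfl
  refine ⟨fun j => if j % 2 = 0 then c (j / 2) else c' (j / 2),
    fun j => if j % 2 = 0 then a (j / 2) else a' (j / 2), ⟨?_, ?_, ?_⟩, ?_⟩
  · intro j
    split_ifs
    · exact h.atom _
    · exact h'.atom _
  · rw [hn]
    exact hs.summable
  · have t1 : Tendsto (fun n : ℕ => (n + 1) / 2) atTop atTop :=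
      tendsto_atTop.2 fun b => (eventually_ge_atTop (2 * b)).mono fun n hn => by omega
    have t2 : Tendsto (fun n : ℕ => n / 2) atTop atTop :=
      tendsto_atTop.2 fun b => (eventually_ge_atTop (2 * b)).mono fun n hn => by omega
    have t3 := (h.tendsto.comp t1).add (h'.tendsto.comp t2)
    rw [add_zero] at t3
    refine tendsto_of_tendsto_of_tendsto_of_le_of_le tendsto_const_nhds t3
      (fun _ => zero_le) fun n => ?_
    refine le_trans (le_of_eq ?_) (eLpNorm_add_le (aesm _ _) (aesm _ _) le_rfl)
    congr 1
    ext x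
    have := sum_range_interleave (fun j => c j * a j x) (fun j => c' j * a' j x) n
    simp only [Pi.add_apply]
    rw [show ∀ p q r s : ℂ, p - q + (r - s) = p + r - (q + s) by intros; ring, ← this]
    congr 1
    refine Finset.sum_congr rfl fun j _ => ?_
    split_ifs <;> rfl
  · rw [hn]
    exact hs.tsum_eq

lemma isAtom_zero (p : ℝ≥0∞) : T.IsAtom p 0 :=
  ⟨{(T.proj (Classical.arbitrary T.geod : V) : V)}, Or.inl ⟨_, rfl⟩, by simp, by simp, by simp⟩

lemma isDecomp_zero (p : ℝ≥0∞) : T.IsDecomp p 0 (fun _ => 0) (fun _ => 0) :=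
  ⟨fun _ => isAtom_zero p, by simp, by simp⟩

variable (T)

/-- `H^{1,p}(μ)` as a vector space of functions: the `g ∈ L¹(μ)` with an atomic decomposition. -/
def hardySubmodule (p : ℝ≥0∞) : Submodule ℂ (V → ℂ) where
  carrier := {g | MemLp g 1 T.μ ∧ ∃ c a, T.IsDecomp p g c a}
  zero_mem' := ⟨MemLp.zero, _, _, isDecomp_zero p⟩
  add_mem' := by
    rintro f g ⟨hf, c, a, h⟩ ⟨hg, c', a', h'⟩
    obtain ⟨d, b, hd, -⟩ := h.add h'
    exact ⟨hf.add hg, d, b, hd⟩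
  smul_mem' := by
    rintro k f ⟨hf, c, a, h⟩
    exact ⟨hf.const_smul k, _, _, h.smul k⟩

/-- `H^1_fin(μ)`: the finite linear combinations of `(1, ∞)`-atoms. -/
def hardyFin : Submodule ℂ (V → ℂ) := Submodule.span ℂ {a | T.IsAtom ∞ a}

/-- The atomic Hardy space `H^1(μ) = H^{1,∞}(μ)`. -/
def HardySpace : Type _ := ↥(T.hardySubmodule ∞)

instance : AddCommGroup T.HardySpace := inferInstanceAs (AddCommGroup ↥(T.hardySubmodule ∞))

instance : Module ℂ T.HardySpace := inferInstanceAs (Module ℂ ↥(T.hardySubmodule ∞))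

instance : Norm T.HardySpace := ⟨fun g => T.hardyNorm ∞ g.1⟩

variable {T}

lemma IsAtom.eLpNorm_one_le {a : V → ℂ} (ha : T.IsAtom ∞ a) : eLpNorm a 1 T.μ ≤ 1 := by
  obtain ⟨R, -, hs, hn, -⟩ := ha
  have hn' : eLpNorm a ∞ T.μ ≤ (T.μ R)⁻¹ := by
    simpa [ENNReal.rpow_neg_one] using hn
  have e : eLpNorm a 1 (T.μ.restrict R) = eLpNorm a 1 T.μ :=
    eLpNorm_restrict_eq_of_support_subset fun x hx => by
      by_contra h
      exact hx (hs x h)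
  have h1 := eLpNorm_le_eLpNorm_mul_rpow_measure_univ (μ := T.μ.restrict R) (p := 1) (q := ∞)
    le_top (aesm _ a)
  rw [e] at h1
  have h2 : eLpNorm a 1 T.μ ≤ eLpNorm a ∞ T.μ * T.μ R := by
    refine h1.trans ?_
    simp only [ENNReal.toReal_one, ENNReal.toReal_top, div_one, div_zero, sub_zero,
      ENNReal.rpow_one, Measure.restrict_apply_univ]
    gcongr
    exact Measure.restrict_le_self
  exact h2.trans ((mul_le_mul_left hn' _).trans (ENNReal.inv_mul_le_one _))

lemma IsDecomp.eLpNorm_le {g : V → ℂ} {c : ℕ → ℂ} {a : ℕ → V → ℂ}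
    (h : T.IsDecomp ∞ g c a) : eLpNorm g 1 T.μ ≤ ENNReal.ofReal (∑' j, ‖c j‖) := by
  have key : ∀ n : ℕ, eLpNorm g 1 T.μ ≤
      eLpNorm (fun x => g x - ∑ j ∈ Finset.range n, c j * a j x) 1 T.μ +
        ENNReal.ofReal (∑' j, ‖c j‖) := by
    intro n
    have e : g = (fun x => g x - ∑ j ∈ Finset.range n, c j * a j x) +
        ∑ j ∈ Finset.range n, c j • a j := by
      ext x
      simp
    conv_lhs => rw [e]
    refine (eLpNorm_add_le (aesm _ _) (aesm _ _) le_rfl).trans ?_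
    gcongr
    refine (eLpNorm_sum_le (fun _ _ => aesm _ _) le_rfl).trans ?_
    have : ∀ j ∈ Finset.range n, eLpNorm (c j • a j) 1 T.μ ≤ ENNReal.ofReal ‖c j‖ := by
      intro j _
      rw [eLpNorm_const_smul, ofReal_norm]
      exact (mul_le_mul_right (h.atom j).eLpNorm_one_le _).trans (by rw [mul_one])
    refine (Finset.sum_le_sum this).trans ?_
    rw [← ENNReal.ofReal_sum_of_nonneg fun _ _ => norm_nonneg _]
    exact ENNReal.ofReal_le_ofReal (h.summable.sum_le_tsum _ fun _ _ => norm_nonneg _)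
  have := h.tendsto.add (tendsto_const_nhds (x := ENNReal.ofReal (∑' j, ‖c j‖)))
  rw [zero_add] at this
  exact ge_of_tendsto' this key

lemma mu_singleton_ne_zero (x : V) : T.μ {x} ≠ 0 := by
  have hm : (0 : ℝ) < m := by exact_mod_cast (lt_of_lt_of_le two_pos T.two_le)
  have : ENNReal.ofReal ((m : ℝ) ^ T.level x) ≠ 0 := by
    simpa using zpow_pos hm (T.level x)
  rw [μ, Measure.sum_apply _ (MeasurableSet.singleton x)]
  intro h
  rw [ENNReal.tsum_eq_zero] at h
  have h1 := h x
  simp [this] at h1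

lemma hardy_core : NormedSpace.Core ℂ T.HardySpace where
  norm_nonneg g := hardyNorm_nonneg _ _
  norm_smul := by
    have hle : ∀ (k : ℂ) (g : T.HardySpace), ‖k • g‖ ≤ ‖k‖ * ‖g‖ := by
      intro k g
      refine le_of_forall_pos_le_add fun ε hε => ?_
      obtain ⟨c, a, h, hlt⟩ := exists_isDecomp_lt g.2.2 (div_pos hε (by positivity : 0 < ‖k‖ + 1))
      have h1 : ‖k • g‖ ≤ ∑' j, ‖k * c j‖ := (h.smul k).hardyNorm_le
      simp only [norm_mul, tsum_mul_left] at h1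
      refine h1.trans ((mul_le_mul_of_nonneg_left hlt.le (norm_nonneg k)).trans ?_)
      have h2 : ‖k‖ * (ε / (‖k‖ + 1)) ≤ ε := by
        rw [mul_div_assoc', div_le_iff₀ (by positivity)]
        nlinarith [norm_nonneg k]
      change ‖k‖ * (‖g‖ + _) ≤ _
      linarith
    intro k g
    refine le_antisymm (hle k g) ?_
    by_cases hk : k = 0
    · subst hk
      rw [norm_zero, zero_mul]
      exact hardyNorm_nonneg _ _
    · have := hle k⁻¹ (k • g)
      rw [inv_smul_smul₀ hk, norm_inv] at this
      rwa [← div_eq_inv_mul, le_div_iff₀' (norm_pos_iff.2 hk)] at this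
  norm_triangle f g := by
    refine le_of_forall_pos_le_add fun ε hε => ?_
    obtain ⟨c, a, h, hlt⟩ := exists_isDecomp_lt f.2.2 (half_pos hε)
    obtain ⟨c', a', h', hlt'⟩ := exists_isDecomp_lt g.2.2 (half_pos hε)
    obtain ⟨d, b, hd, hs⟩ := h.add h'
    have h1 : ‖f + g‖ ≤ _ := hd.hardyNorm_le
    change _ < ‖f‖ + _ at hlt
    change _ < ‖g‖ + _ at hlt'
    linarith
  norm_eq_zero_iff g := by
    constructor
    · intro h0
      have : eLpNorm g.1 1 T.μ = 0 := by
        by_contra hne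
        have hpos : 0 < (eLpNorm g.1 1 T.μ).toReal := ENNReal.toReal_pos hne g.2.1.2.ne
        obtain ⟨c, a, h, hlt⟩ := exists_isDecomp_lt g.2.2 hpos
        change _ < ‖g‖ + _ at hlt
        rw [h0, zero_add] at hlt
        have := ENNReal.toReal_mono ENNReal.ofReal_ne_top h.eLpNorm_le
        rw [ENNReal.toReal_ofReal (tsum_nonneg fun _ => norm_nonneg _)] at this
        linarith
      rw [eLpNorm_eq_zero_iff (aesm _ _) one_ne_zero] at this
      apply Subtype.ext
      ext x
      by_contra hx
      refine mu_singleton_ne_zero (T := T) x (measure_mono_null ?_ this)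
      rintro _ rfl
      exact hx
    · rintro rfl
      refine le_antisymm ?_ (hardyNorm_nonneg _ _)
      have : T.hardyNorm ∞ 0 ≤ _ := (isDecomp_zero (T := T) ∞).hardyNorm_le
      simp only [norm_zero, tsum_zero] at this
      exact this

instance : NormedAddCommGroup T.HardySpace := NormedAddCommGroup.ofCore hardy_core

instance : NormedSpace ℂ T.HardySpace := NormedSpace.ofCore hardy_core

lemma hardyFin_le : T.hardyFin ≤ T.hardySubmodule ∞ := by
  refine Submodule.span_le.2 fun a ha => ?_
  refine ⟨⟨aesm _ _, lt_of_le_of_lt (IsAtom.eLpNorm_one_le ha) ENNReal.one_lt_top⟩,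
    fun j => if j = 0 then 1 else 0, fun _ => a, fun _ => ha, ?_, ?_⟩
  · refine summable_of_ne_finset_zero (s := {0}) fun j hj => ?_
    simp at hj
    simp [hj]
  · refine tendsto_atTop_of_eventually_const (i₀ := 1) fun n hn => ?_
    have : 0 < n := hn
    simp [this]

variable (T)

/-- The inclusion of `H^1_fin(μ)` in `H^1(μ)`. -/
def finToHardy (g : T.hardyFin) : T.HardySpace := ⟨g.1, hardyFin_le g.2⟩

/-- `C` is a constant for which `H^{1,p}(μ) = H^{1,∞}(μ)` with
`‖g‖_{H^{1,p}} ≤ ‖g‖_{H^{1,∞}} ≤ C ‖g‖_{H^{1,p}}`. -/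
def IsComparisonConst (p : ℝ≥0∞) (C : ℝ) : Prop :=
  T.hardySubmodule p = T.hardySubmodule ∞ ∧ ∀ g ∈ T.hardySubmodule p,
    T.hardyNorm p g ≤ T.hardyNorm ∞ g ∧ T.hardyNorm ∞ g ≤ C * T.hardyNorm p g

/-- The mean oscillation of `f` on `R`. -/
def osc (f : V → ℂ) (R : Set V) : ℝ := ⨍ x in R, ‖f x - ⨍ y in R, f y ∂T.μ‖ ∂T.μ

variable {T}

lemma osc_eq_zero {R : Set V} (h : T.μ.real R = 0) (f : V → ℂ) : T.osc f R = 0 := by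
  rw [osc, setAverage_eq, h, inv_zero, zero_smul]

lemma osc_add_le {f g : V → ℂ} {R : Set V} (hf : IntegrableOn f R T.μ)
    (hg : IntegrableOn g R T.μ) : T.osc (f + g) R ≤ T.osc f R + T.osc g R := by
  by_cases hR : T.μ.real R = 0
  · simp [osc_eq_zero hR]
  have hfin : T.μ R ≠ ∞ := fun h => hR (by simp [Measure.real, h])
  have hi : ∀ {u : V → ℂ} (k : ℂ), IntegrableOn u R T.μ →
      IntegrableOn (fun x => ‖u x - k‖) R T.μ := fun k hu =>
    (Integrable.sub hu (integrableOn_const hfin)).norm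
  have hav : ⨍ y in R, (f + g) y ∂T.μ = ⨍ y in R, f y ∂T.μ + ⨍ y in R, g y ∂T.μ := by
    simp only [setAverage_eq, Pi.add_apply]
    rw [integral_add hf hg, smul_add]
  rw [osc, osc, osc, hav]
  generalize (⨍ y in R, f y ∂T.μ) = k
  generalize (⨍ y in R, g y ∂T.μ) = l
  rw [setAverage_eq, setAverage_eq, setAverage_eq, ← smul_add, ← integral_add (hi _ hf) (hi _ hg)]
  refine smul_le_smul_of_nonneg_left ?_ (by positivity)
  refine integral_mono (hi _ (hf.add hg)) ((hi _ hf).add (hi _ hg)) fun x => ?_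
  simp only [Pi.add_apply]
  rw [add_sub_add_comm]
  exact norm_add_le _ _

lemma osc_smul (k : ℂ) (f : V → ℂ) (R : Set V) : T.osc (k • f) R = ‖k‖ * T.osc f R := by
  simp only [osc, setAverage_eq, Pi.smul_apply, smul_eq_mul, integral_const_mul]
  have : ∀ x, ‖k * f x - (T.μ.real R)⁻¹ • (k * ∫ y in R, f y ∂T.μ)‖ =
      ‖k‖ * ‖f x - (T.μ.real R)⁻¹ • ∫ y in R, f y ∂T.μ‖ := by
    intro x
    rw [← norm_mul, mul_sub, mul_smul_comm]
  simp only [this, integral_const_mul]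
  ring

lemma osc_const (k : ℂ) (R : Set V) : T.osc (fun _ => k) R = 0 := by
  by_cases hR : T.μ.real R = 0
  · exact osc_eq_zero hR _
  · simp [osc, setAverage_eq, hR]

variable (T)

/-- The space of functions of bounded mean oscillation (before the quotient by constants). The
vertex set is discrete and every Calderón–Zygmund set is finite, so the integrability condition
expresses local integrability. -/
def bmoSubmodule : Submodule ℂ (V → ℂ) where
  carrier := {f | (∀ R, T.IsCZ R → IntegrableOn f R T.μ) ∧
    BddAbove (Set.range fun R : {R : Set V // T.IsCZ R} => T.osc f R)}
  zero_mem' := by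
    refine ⟨fun R _ => integrableOn_zero, 0, ?_⟩
    rintro _ ⟨R, rfl⟩
    exact (osc_const 0 R.1).le
  add_mem' := by
    rintro f g ⟨hf, A, hA⟩ ⟨hg, B, hB⟩
    refine ⟨fun R hR => (hf R hR).add (hg R hR), A + B, ?_⟩
    rintro _ ⟨R, rfl⟩
    exact (osc_add_le (hf R R.2) (hg R R.2)).trans (add_le_add (hA ⟨R, rfl⟩) (hB ⟨R, rfl⟩))
  smul_mem' := by
    rintro k f ⟨hf, A, hA⟩
    refine ⟨fun R hR => (hf R hR).smul k, ‖k‖ * A, ?_⟩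
    rintro _ ⟨R, rfl⟩
    exact (osc_smul k f R).le.trans (mul_le_mul_of_nonneg_left (hA ⟨R, rfl⟩) (norm_nonneg k))

/-- The constant functions, inside the space of functions of bounded mean oscillation. -/
def bmoConst : Submodule ℂ T.bmoSubmodule :=
  (Submodule.span ℂ {fun _ : V => (1 : ℂ)}).comap T.bmoSubmodule.subtype

/-- `BMO_1(μ)`: functions of bounded mean oscillation modulo constants. -/
def BMO : Type _ := ↥T.bmoSubmodule ⧸ T.bmoConst

instance : AddCommGroup T.BMO := inferInstanceAs (AddCommGroup (↥T.bmoSubmodule ⧸ T.bmoConst))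

instance : Module ℂ T.BMO := inferInstanceAs (Module ℂ (↥T.bmoSubmodule ⧸ T.bmoConst))

/-- The class modulo constants of a function of bounded mean oscillation. -/
def bmoMk : T.bmoSubmodule →ₗ[ℂ] T.BMO := T.bmoConst.mkQ

variable {T}

lemma osc_congr {f g : T.bmoSubmodule} (h : f - g ∈ T.bmoConst) {R : Set V} (hR : T.IsCZ R) :
    T.osc f.1 R ≤ T.osc g.1 R := by
  obtain ⟨k, hk⟩ := Submodule.mem_span_singleton.1 h
  have hk' : k • (fun _ : V => (1 : ℂ)) = f.1 - g.1 := hk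
  have e : f.1 = g.1 + k • (fun _ : V => (1 : ℂ)) := by rw [hk']; abel
  have hi : IntegrableOn (k • (fun _ : V => (1 : ℂ))) R T.μ := by
    rw [hk']
    exact (f.2.1 R hR).sub (g.2.1 R hR)
  rw [e]
  refine (osc_add_le (g.2.1 R hR) hi).trans ?_
  rw [osc_smul, osc_const, mul_zero, add_zero]

variable (T)

/-- The norm of `BMO_1(μ)`: the supremum over the Calderón–Zygmund sets of the mean oscillation of
any representative. -/
instance : Norm T.BMO where
  norm := Quotient.lift (s := T.bmoConst.quotientRel)
    (fun f : T.bmoSubmodule => ⨆ R : {R : Set V // T.IsCZ R}, T.osc f.1 R) (by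
      intro f g h
      have h1 : f - g ∈ T.bmoConst := (Submodule.quotientRel_def _).1 h
      have h2 : g - f ∈ T.bmoConst := by simpa using T.bmoConst.neg_mem h1
      congr 1
      ext R
      exact le_antisymm (osc_congr h1 R.2) (osc_congr h2 R.2))

lemma norm_bmoMk (f : T.bmoSubmodule) :
    ‖T.bmoMk f‖ = ⨆ R : {R : Set V // T.IsCZ R}, T.osc f.1 R := rfl

/-- `L = L_f`: the functional `L` is integration against (any representative of) `f` on finite
linear combinations of atoms. -/
def Represents (L : StrongDual ℂ T.HardySpace) (f : T.BMO) : Prop :=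
  ∀ F : T.bmoSubmodule, T.bmoMk F = f →
    ∀ g : T.hardyFin, L (T.finToHardy g) = ∫ x, F.1 x * g.1 x ∂T.μ

end WeightedTree

end

/-! The level function is a Busemann function, so every vertex has one parent and m children. A
vertex has the same mass as all its children together, so each generation below `r` has mass `weight
r`. A non-degenerate Calderón–Zygmund set is therefore a union of consecutive generations (`box`),
with mass equal to the number of generations times `weight r`.

Any two vertices lie in a common Calderón–Zygmund set, so differences of normalized point masses
(`dipole`) belong to `hardyFin`; they span it. A bounded functional `L` is thus integration against
a function `f` on `hardyFin` (`exists_function`), unique up to a constant. Testing on bounded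
functions of mean zero gives mean oscillation at most `2‖L‖` (`sum_osc_le_two_mul`).

The equality of `H^{1,2}` and `H^{1,∞}` is obtained by duality, without decomposing atoms
explicitly. A (1,2)-atom `a` has finite support, so it already lies in `hardyFin`, and only a
uniform bound on its norm is needed. Hahn–Banach gives `L` of norm at most 1 with `L a = ‖a‖`; the
function representing `L` has bounded mean oscillation, hence bounded mean square oscillation by
John–Nirenberg (`sum_sq_osc_le`), and Cauchy–Schwarz bounds `L a`. John–Nirenberg itself is a
stopping argument on boxes that split down to single vertices into pieces of comparable mass.

Given a comparison constant `C`, pairing `f` with the conjugate of `f - f_R` on `R`, a multiple of a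
(1,2)-atom, bounds the square oscillation and yields exactly `C‖L‖`
(`IsComparisonConst.sum_osc_le`).

Conversely, for `f` in BMO and `g` in H¹ the product `f g` need not be integrable. The pairing is
defined as the limit of the integrals of `truncate N f * g`. Truncation is 1-Lipschitz, so the
pairing with each atom is bounded by the BMO norm uniformly in `N`; this gives `A = 1`. Density of
`hardyFin` makes the functional unique. -/

noncomputable section

namespace WeightedTree

/-! ### Genealogy of the tree: the level as a Busemann function, parents and children. -/

section Geometry

variable {V : Type*} {m : ℕ} (T : WeightedTree V m)

lemma N_injective : Function.Injective T.N := by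
  intro x y h
  have h1 := T.N_isometry x y
  rw [h, sub_self, abs_zero] at h1
  exact Subtype.ext (T.isTree.connected.dist_eq_zero_iff.1 (by exact_mod_cast h1.symm))

lemma geod_adj {x y : T.geod} (h : T.N y = T.N x + 1) : T.graph.Adj (x : V) (y : V) := by
  have h1 := T.N_isometry y x
  rw [h, add_sub_cancel_left, abs_one] at h1
  exact SimpleGraph.Adj.symm (SimpleGraph.dist_eq_one_iff_adj.1 (by exact_mod_cast h1.symm))

lemma exists_N_eq_add_one (z : T.geod) : ∃ z' : T.geod, T.N z' = T.N z + 1 := by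
  obtain ⟨a, b, hab, hs⟩ := Set.ncard_eq_two.1 (T.geod_two z z.2)
  have key : ∀ c ∈ T.graph.neighborSet z ∩ T.geod, ∃ hc : c ∈ T.geod,
      T.N ⟨c, hc⟩ = T.N z + 1 ∨ T.N ⟨c, hc⟩ = T.N z - 1 := by
    rintro c ⟨hc1, hc2⟩
    refine ⟨hc2, ?_⟩
    have h1 := T.N_isometry ⟨c, hc2⟩ z
    rw [SimpleGraph.dist_eq_one_iff_adj.2 (SimpleGraph.Adj.symm hc1)] at h1
    rcases abs_cases (T.N ⟨c, hc2⟩ - T.N z) with h | h <;> omega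
  obtain ⟨ha, ha'⟩ := key a (by simp [hs])
  obtain ⟨hb, hb'⟩ := key b (by simp [hs])
  have hne : T.N ⟨a, ha⟩ ≠ T.N ⟨b, hb⟩ := fun h => hab (by simpa using T.N_injective h)
  rcases ha' with h | h
  · exact ⟨_, h⟩
  · exact ⟨_, hb'.resolve_right (fun h' => hne (h.trans h'.symm))⟩

lemma exists_N_eq_add (z : T.geod) (k : ℕ) : ∃ z' : T.geod, T.N z' = T.N z + k := by
  induction k with
  | zero => exact ⟨z, by simp⟩
  | succ k ih =>
    obtain ⟨z', h⟩ := ih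
    obtain ⟨z'', h'⟩ := T.exists_N_eq_add_one z'
    exact ⟨z'', by rw [h', h]; push_cast; ring⟩

/-- Provides one vertex high on the geodesic through which the levels of two vertices can be
compared by `level_eq`. -/
lemma exists_N_ge (i j : ℤ) : ∃ z : T.geod, i ≤ T.N z ∧ j ≤ T.N z := by
  obtain ⟨z₀⟩ := T.instNonemptyGeod
  obtain ⟨z, hz⟩ := T.exists_N_eq_add z₀ ((i - T.N z₀).toNat + (j - T.N z₀).toNat)
  exact ⟨z, by omega, by omega⟩

/-- Both edges begin a shortest path from `x` to `z`, and a tree has only one path between two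
vertices. -/
lemma closer_unique {x y y' z : V} (h : T.graph.Adj x y) (h' : T.graph.Adj x y')
    (hd : T.graph.dist y z + 1 = T.graph.dist x z)
    (hd' : T.graph.dist y' z + 1 = T.graph.dist x z) : y = y' := by
  obtain ⟨p, hp⟩ := T.isTree.connected.exists_walk_length_eq_dist y z
  obtain ⟨p', hp'⟩ := T.isTree.connected.exists_walk_length_eq_dist y' z
  have h1 : (SimpleGraph.Walk.cons h p).IsPath :=
    SimpleGraph.Walk.isPath_of_length_eq_dist _ (by simp [hp, hd])
  have h2 : (SimpleGraph.Walk.cons h' p').IsPath :=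
    SimpleGraph.Walk.isPath_of_length_eq_dist _ (by simp [hp', hd'])
  have h3 := (T.isTree.isAcyclic.subsingleton_path x z).elim ⟨_, h1⟩ ⟨_, h2⟩
  have h4 := congrArg (fun q : T.graph.Path x z => q.1.snd) h3
  simpa using h4

lemma dist_proj_le (x : V) (z : T.geod) :
    T.graph.dist x (T.proj x : V) ≤ T.graph.dist x (z : V) :=
  Function.argmin_le (fun z : T.geod => T.graph.dist x (z : V)) z

/-- Each step up the geodesic changes the distance to `x` by one. The first step cannot decrease it,
because the projection is nearest; a later one cannot, because the only neighbour closer to `x` is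
the vertex just left. -/
lemma dist_geod_of_ge (x : V) (k : ℕ) : ∀ z : T.geod, T.N z = T.N (T.proj x) + k →
    T.graph.dist x (z : V) = T.graph.dist x (T.proj x : V) + k := by
  induction k using Nat.strong_induction_on with
  | _ k ih =>
    intro z hz
    rcases k with _ | k
    · have : z = T.proj x := T.N_injective (by simpa using hz)
      simp [this]
    · obtain ⟨z₁, hz₁⟩ := T.exists_N_eq_add (T.proj x) k
      have h1 := ih k (by omega) z₁ hz₁
      have hadj : T.graph.Adj (z₁ : V) (z : V) := T.geod_adj (by rw [hz, hz₁]; push_cast; ring)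
      rcases T.isTree.dist_eq_dist_add_one_of_adj x hadj with h2 | h2
      · exfalso
        rcases k with _ | k
        · have := T.dist_proj_le x z
          omega
        · obtain ⟨z₂, hz₂⟩ := T.exists_N_eq_add (T.proj x) k
          have h3 := ih k (by omega) z₂ hz₂
          have hadj' : T.graph.Adj (z₂ : V) (z₁ : V) :=
            T.geod_adj (by rw [hz₁, hz₂]; push_cast; ring)
          have h4 : (z : V) = z₂ := by
            refine T.closer_unique (z := x) hadj hadj'.symm ?_ ?_
            · rw [SimpleGraph.dist_comm, ← h2, SimpleGraph.dist_comm]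
            · rw [SimpleGraph.dist_comm, h3, SimpleGraph.dist_comm (u := (z₁ : V)), h1]; ring
          have h5 : z = z₂ := Subtype.ext h4
          rw [h5, hz₂] at hz
          push_cast at hz
          omega
      · omega

/-- The level function is the Busemann function of the upper end of the geodesic. -/
lemma level_eq (x : V) (z : T.geod) (h : T.N (T.proj x) ≤ T.N z) :
    T.level x = T.N z - (T.graph.dist x (z : V) : ℤ) := by
  have h1 : T.N z = T.N (T.proj x) + ((T.N z - T.N (T.proj x)).toNat : ℕ) := by omega
  have h2 := T.dist_geod_of_ge x _ z h1
  rw [level, h2]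
  push_cast
  omega

lemma level_adj {x y : V} (h : T.graph.Adj x y) :
    T.level y = T.level x + 1 ∨ T.level x = T.level y + 1 := by
  obtain ⟨z, hx, hy⟩ := T.exists_N_ge (T.N (T.proj x)) (T.N (T.proj y))
  rw [T.level_eq x z hx, T.level_eq y z hy]
  rw [SimpleGraph.dist_comm (u := x), SimpleGraph.dist_comm (u := y)]
  rcases T.isTree.dist_eq_dist_add_one_of_adj (z : V) h with h2 | h2 <;> rw [h2] <;> push_cast
  · left; ring
  · right; ring

lemma level_geod (z : T.geod) : T.level (z : V) = T.N z := by
  have h := T.dist_proj_le (z : V) z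
  rw [SimpleGraph.dist_self, Nat.le_zero, T.isTree.connected.dist_eq_zero_iff] at h
  rw [level, ← Subtype.ext h, SimpleGraph.dist_self]
  simp

lemma upper_unique {x y y' : V} (h : T.graph.Adj x y) (h' : T.graph.Adj x y')
    (hl : T.level y = T.level x + 1) (hl' : T.level y' = T.level x + 1) : y = y' := by
  obtain ⟨z₁, hx, hy⟩ := T.exists_N_ge (T.N (T.proj x)) (T.N (T.proj y))
  obtain ⟨z, hz, hy'⟩ := T.exists_N_ge (T.N z₁) (T.N (T.proj y'))
  have e1 := T.level_eq x z (hx.trans hz)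
  have e2 := T.level_eq y z (hy.trans hz)
  have e3 := T.level_eq y' z hy'
  exact T.closer_unique (z := z) h h' (by omega) (by omega)

lemma exists_upper (x : V) : ∃ y, T.graph.Adj x y ∧ T.level y = T.level x + 1 := by
  -- The upper neighbour is the first vertex on a shortest path to the geodesic vertex one above the
  -- projection; going one above keeps this path nonempty even when `x` is on the geodesic.
  obtain ⟨z, hz⟩ := T.exists_N_eq_add (T.proj x) 1
  have hd := T.dist_geod_of_ge x 1 z hz
  obtain ⟨p, hp⟩ := T.isTree.connected.exists_walk_length_eq_dist x (z : V)
  cases p with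
  | nil =>
    rw [SimpleGraph.Walk.length_nil] at hp
    omega
  | @cons _ y _ h q =>
    refine ⟨y, h, ?_⟩
    simp only [SimpleGraph.Walk.length_cons] at hp
    have hq := SimpleGraph.dist_le q
    obtain ⟨z', h1, h2⟩ := T.exists_N_ge (T.N z) (T.N (T.proj y))
    have e1 := T.level_eq x z' (by omega)
    have e2 := T.level_eq y z' h2
    have e3 := T.level_eq x z (by omega)
    have tri := T.isTree.connected.dist_triangle (u := y) (v := (z : V)) (w := (z' : V))
    have e4 := T.N_isometry z' z
    rw [abs_of_nonneg (by omega), SimpleGraph.dist_comm] at e4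
    rcases T.level_adj h with h3 | h3 <;> omega

/-- The neighbour of `x` one level above `x`. -/
def parent (x : V) : V := (T.exists_upper x).choose

lemma adj_parent (x : V) : T.graph.Adj x (T.parent x) := (T.exists_upper x).choose_spec.1

lemma level_parent (x : V) : T.level (T.parent x) = T.level x + 1 :=
  (T.exists_upper x).choose_spec.2

lemma eq_parent {x y : V} (h : T.graph.Adj x y) (hl : T.level y = T.level x + 1) :
    y = T.parent x :=
  T.upper_unique h (T.adj_parent x) hl (T.level_parent x)

lemma level_iterate_parent (x : V) (k : ℕ) : T.level (T.parent^[k] x) = T.level x + k := by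
  induction k with
  | zero => simp
  | succ k ih =>
    rw [Function.iterate_succ_apply', level_parent, ih]
    push_cast
    ring

/-- A step gains at most one level, and gains it only by moving to the parent. This is what
identifies lying below with being a descendant. -/
lemma level_le_add_length {x y : V} (p : T.graph.Walk x y) :
    T.level y ≤ T.level x + p.length ∧
      (T.level y = T.level x + p.length → T.parent^[p.length] x = y) := by
  induction p with
  | nil => simp
  | @cons u v w h p ih =>
    simp only [SimpleGraph.Walk.length_cons, Nat.cast_add, Nat.cast_one]
    have h1 := T.level_adj h
    refine ⟨by omega, fun h2 => ?_⟩
    rw [Function.iterate_succ_apply, ← T.eq_parent h (by omega)]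
    exact ih.2 (by omega)

lemma dist_iterate_parent_le (x : V) (k : ℕ) : T.graph.dist x (T.parent^[k] x) ≤ k := by
  induction k with
  | zero => simp
  | succ k ih =>
    rw [Function.iterate_succ_apply']
    refine (T.isTree.connected.dist_triangle (v := T.parent^[k] x)).trans ?_
    rw [SimpleGraph.dist_eq_one_iff_adj.2 (T.adj_parent _)]
    omega

lemma liesBelow_iff {x y : V} : T.LiesBelow x y ↔ ∃ k : ℕ, T.parent^[k] x = y := by
  constructor
  · intro h
    obtain ⟨p, hp⟩ := T.isTree.connected.exists_walk_length_eq_dist x y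
    refine ⟨p.length, (T.level_le_add_length p).2 ?_⟩
    rw [LiesBelow] at h
    omega
  · rintro ⟨k, rfl⟩
    obtain ⟨p, hp⟩ := T.isTree.connected.exists_walk_length_eq_dist x (T.parent^[k] x)
    have h1 := (T.level_le_add_length p).1
    have h2 := T.dist_iterate_parent_le x k
    have h3 := T.level_iterate_parent x k
    rw [LiesBelow]
    omega

lemma m_pos (T : WeightedTree V m) : (0 : ℝ) < m := by
  exact_mod_cast lt_of_lt_of_le two_pos T.two_le

lemma neighborSet_finite (x : V) : (T.graph.neighborSet x).Finite :=
  Set.finite_of_ncard_ne_zero (by rw [T.regular]; omega)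

lemma setOf_parent_eq (x : V) : {y | T.parent y = x} = T.graph.neighborSet x \ {T.parent x} := by
  ext y
  simp only [Set.mem_ofPred_eq, Set.mem_sdiff, SimpleGraph.mem_neighborSet, Set.mem_singleton_iff]
  constructor
  · rintro rfl
    refine ⟨(T.adj_parent y).symm, fun h => ?_⟩
    have := congrArg T.level h
    rw [level_parent, level_parent] at this
    omega
  · rintro ⟨h1, h2⟩
    rcases T.level_adj h1 with h | h
    · exact absurd (T.eq_parent h1 h) h2
    · exact (T.eq_parent h1.symm h).symm

/-- The vertices immediately below `x`. -/
def children (x : V) : Finset V :=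
  Set.Finite.toFinset (s := {y | T.parent y = x})
    (by rw [setOf_parent_eq]; exact (T.neighborSet_finite x).sdiff)

lemma mem_children {x y : V} : y ∈ T.children x ↔ T.parent y = x := by simp [children]

lemma card_children (x : V) : (T.children x).card = m := by
  have h : T.parent x ∈ T.graph.neighborSet x := T.adj_parent x
  rw [children, ← Set.ncard_eq_toFinset_card _ _, setOf_parent_eq,
    Set.ncard_sdiff_singleton_of_mem h, T.regular, Nat.add_sub_cancel]

/-! ### Descendants, boxes and their masses. -/

open Classical in
/-- The vertices lying `k` levels below `r`. -/
def descendants (r : V) : ℕ → Finset V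
  | 0 => {r}
  | k + 1 => (T.children r).biUnion fun s => descendants s k

lemma mem_descendants {k : ℕ} : ∀ {r x : V}, x ∈ T.descendants r k ↔ T.parent^[k] x = r := by
  induction k with
  | zero => simp [descendants]
  | succ k ih =>
    intro r x
    simp [descendants, ih, mem_children, Function.iterate_succ_apply']

lemma sum_descendants_succ {M : Type*} [AddCommMonoid M] (g : V → M) (r : V) (k : ℕ) :
    ∑ x ∈ T.descendants r (k + 1), g x =
      ∑ s ∈ T.children r, ∑ x ∈ T.descendants s k, g x := by
  classical
  rw [descendants, Finset.sum_biUnion]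
  intro s _ s' _ hne
  simp only [Function.onFun]
  rw [Finset.disjoint_left]
  intro x hx hx'
  exact hne ((T.mem_descendants.1 hx).symm.trans (T.mem_descendants.1 hx'))

open Classical in
/-- The vertices below `r` at depth in `[a, b)`. -/
def box (r : V) (a b : ℕ) : Finset V := (Finset.Ico a b).biUnion (T.descendants r)

lemma mem_box {r x : V} {a b : ℕ} :
    x ∈ T.box r a b ↔ ∃ k, (a ≤ k ∧ k < b) ∧ T.parent^[k] x = r := by
  simp [box, mem_descendants]

lemma sum_box {M : Type*} [AddCommMonoid M] (g : V → M) (r : V) (a b : ℕ) :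
    ∑ x ∈ T.box r a b, g x = ∑ k ∈ Finset.Ico a b, ∑ x ∈ T.descendants r k, g x := by
  classical
  rw [box, Finset.sum_biUnion]
  intro k _ k' _ hne
  simp only [Function.onFun]
  rw [Finset.disjoint_left]
  intro x hx hx'
  have h1 := congrArg T.level (T.mem_descendants.1 hx)
  have h2 := congrArg T.level (T.mem_descendants.1 hx')
  rw [level_iterate_parent] at h1 h2
  omega

lemma sum_box_children {M : Type*} [AddCommMonoid M] (g : V → M) (r : V) (a b : ℕ) :
    ∑ x ∈ T.box r (a + 1) (b + 1), g x = ∑ s ∈ T.children r, ∑ x ∈ T.box s a b, g x := by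
  rw [sum_box, ← Finset.sum_Ico_add']
  simp only [sum_descendants_succ, sum_box]
  rw [Finset.sum_comm]

lemma sum_box_consecutive {M : Type*} [AddCommMonoid M] (g : V → M) (r : V) {a b c : ℕ}
    (hab : a ≤ b) (hbc : b ≤ c) :
    ∑ x ∈ T.box r a c, g x = ∑ x ∈ T.box r a b, g x + ∑ x ∈ T.box r b c, g x := by
  simp only [sum_box]
  rw [Finset.sum_Ico_consecutive _ hab hbc]

lemma box_mono {r : V} {a b a' b' : ℕ} (h : a' ≤ a) (h' : b ≤ b') :
    T.box r a b ⊆ T.box r a' b' := by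
  intro x hx
  obtain ⟨k, hk, e⟩ := T.mem_box.1 hx
  exact T.mem_box.2 ⟨k, ⟨h.trans hk.1, hk.2.trans_le h'⟩, e⟩

lemma box_subset_parent (r : V) (a b : ℕ) : T.box r a b ⊆ T.box (T.parent r) (a + 1) (b + 1) := by
  intro x hx
  obtain ⟨k, hk, e⟩ := T.mem_box.1 hx
  exact T.mem_box.2 ⟨k + 1, ⟨by omega, by omega⟩, by rw [Function.iterate_succ_apply', e]⟩

lemma box_zero_one (r : V) : T.box r 0 1 = {r} := by
  ext x
  rw [mem_box, Finset.mem_singleton]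
  constructor
  · rintro ⟨k, hk, e⟩
    obtain rfl : k = 0 := by omega
    exact e
  · rintro rfl
    exact ⟨0, by simp⟩

/-- The mass of a vertex. -/
def weight (x : V) : ℝ := (m : ℝ) ^ T.level x

lemma weight_pos (x : V) : 0 < T.weight x := zpow_pos T.m_pos _

lemma weight_parent (x : V) : T.weight (T.parent x) = m * T.weight x := by
  rw [weight, weight, level_parent, zpow_add_one₀ T.m_pos.ne', mul_comm]

/-- Each of the m children of a vertex has 1/m of its mass, so mass is preserved from one generation
to the next. -/
lemma sum_weight_descendants (k : ℕ) :
    ∀ r : V, ∑ x ∈ T.descendants r k, T.weight x = T.weight r := by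
  induction k with
  | zero => simp [descendants]
  | succ k ih =>
    intro r
    rw [sum_descendants_succ]
    have : ∀ s ∈ T.children r, ∑ x ∈ T.descendants s k, T.weight x = (m : ℝ)⁻¹ * T.weight r := by
      intro s hs
      rw [ih s, ← T.mem_children.1 hs, weight_parent, inv_mul_cancel_left₀ T.m_pos.ne']
    rw [Finset.sum_congr rfl this, Finset.sum_const, card_children, nsmul_eq_mul,
      mul_inv_cancel_left₀ T.m_pos.ne']

lemma sum_weight_box (r : V) {a b : ℕ} (h : a ≤ b) :
    ∑ x ∈ T.box r a b, T.weight x = ((b : ℝ) - a) * T.weight r := by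
  rw [sum_box]
  simp only [sum_weight_descendants, Finset.sum_const, Nat.card_Ico, nsmul_eq_mul]
  rw [Nat.cast_sub h]

/-- Depths are integers, so the lower bound h/2 may be rounded up to `(h + 1) / 2`. -/
lemma trapezoid_eq_box (r : V) {h : ℕ} :
    T.trapezoid r ((h : ℝ) / 2) (4 * h) = T.box r ((h + 1) / 2) (4 * h) := by
  ext x
  rw [Finset.mem_coe, mem_box, trapezoid, Set.mem_ofPred_eq, liesBelow_iff]
  constructor
  · rintro ⟨⟨k, rfl⟩, h1, h2⟩
    rw [level_iterate_parent, add_sub_cancel_left] at h1 h2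
    push_cast at h1 h2
    have h3 : (h : ℝ) ≤ 2 * k := by linarith
    have h4 : h ≤ 2 * k := by exact_mod_cast h3
    have h5 : k < 4 * h := by exact_mod_cast h2
    exact ⟨k, ⟨by omega, h5⟩, rfl⟩
  · rintro ⟨k, ⟨h1, h2⟩, rfl⟩
    rw [level_iterate_parent, add_sub_cancel_left]
    have h4 : h ≤ 2 * k := by omega
    have h3 : (h : ℝ) ≤ 2 * k := by exact_mod_cast h4
    have h5 : (k : ℝ) < 4 * h := by exact_mod_cast h2
    refine ⟨⟨k, rfl⟩, ?_, ?_⟩ <;> push_cast <;> linarith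

lemma isCZ_box (r : V) {h : ℕ} (hh : 0 < h) : T.IsCZ (T.box r ((h + 1) / 2) (4 * h) : Set V) :=
  Or.inr ⟨r, h, hh, (T.trapezoid_eq_box r).symm⟩

lemma isCZ_iff {R : Set V} : T.IsCZ R ↔ (∃ r : V, R = {r}) ∨
    ∃ (r : V) (h : ℕ), 0 < h ∧ R = T.box r ((h + 1) / 2) (4 * h) := by
  simp only [IsCZ, trapezoid_eq_box]

lemma isCZ_singleton (r : V) : T.IsCZ {r} := Or.inl ⟨r, rfl⟩

variable {T} in
lemma IsCZ.exists_finset {R : Set V} (hR : T.IsCZ R) :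
    ∃ B : Finset V, R = B ∧ 0 < ∑ x ∈ B, T.weight x := by
  rcases T.isCZ_iff.1 hR with ⟨r, rfl⟩ | ⟨r, h, hh, rfl⟩
  · exact ⟨{r}, by simp, by simpa using T.weight_pos r⟩
  · refine ⟨_, rfl, ?_⟩
    rw [T.sum_weight_box _ (by omega)]
    refine mul_pos (sub_pos.2 ?_) (T.weight_pos r)
    have : (h + 1) / 2 < 4 * h := by omega
    exact_mod_cast this

lemma exists_isCZ_pair (x y : V) : ∃ R, T.IsCZ R ∧ x ∈ R ∧ y ∈ R := by
  have key : ∀ u : V, ∀ z : T.geod, T.N (T.proj u) ≤ T.N z → ∃ k : ℕ, T.parent^[k] u = z ∧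
      T.N z = T.level u + k := by
    intro u z hz
    have h1 := T.level_eq u z hz
    obtain ⟨k, hk⟩ := T.liesBelow_iff.1 (show T.LiesBelow u z by rw [LiesBelow, level_geod, h1])
    refine ⟨k, hk, ?_⟩
    rw [← T.level_geod z, ← hk, level_iterate_parent]
  -- With `i`, `j` the depths of `x`, `y` below `z`, the thresholds say `j ≤ 2 * i`, `i ≤ 2 * j` and
  -- `1 ≤ i`, so both depths fit in the box with `h = max i j`.
  obtain ⟨z, h1, h2⟩ := T.exists_N_ge
    (max (T.N (T.proj x)) (max (2 * T.level x - T.level y) (T.level x + 1)))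
    (max (T.N (T.proj y)) (2 * T.level y - T.level x))
  obtain ⟨i, hi, hi'⟩ := key x z (by omega)
  obtain ⟨j, hj, hj'⟩ := key y z (by omega)
  refine ⟨_, T.isCZ_box (z : V) (h := max i j) (by omega), ?_, ?_⟩
  · exact Finset.mem_coe.2 (T.mem_box.2 ⟨i, ⟨by omega, by omega⟩, hi⟩)
  · exact Finset.mem_coe.2 (T.mem_box.2 ⟨j, ⟨by omega, by omega⟩, hj⟩)

end Geometry

end WeightedTree

/-! ### An abstract John–Nirenberg inequality in L² by a stopping argument. -/

section JohnNirenberg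

universe u

variable {V : Type u} (w : V → ℝ)

/-- The average of `f` over `B` with respect to the weight `w`. -/
def weightedAvg (f : V → ℂ) (B : Finset V) : ℂ :=
  ((∑ x ∈ B, w x : ℝ) : ℂ)⁻¹ * ∑ x ∈ B, (w x : ℂ) * f x

variable {w}

lemma sum_weight_mul_sub (f : V → ℂ) {B : Finset V} (hB : 0 < ∑ x ∈ B, w x) (c : ℂ) :
    ∑ x ∈ B, (w x : ℂ) * (f x - c) = ((∑ x ∈ B, w x : ℝ) : ℂ) * (weightedAvg w f B - c) := by
  have h : ((∑ x ∈ B, w x : ℝ) : ℂ) ≠ 0 := by exact_mod_cast hB.ne'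
  rw [weightedAvg, mul_sub, mul_inv_cancel_left₀ h]
  simp only [mul_sub, Finset.sum_sub_distrib, Complex.ofReal_sum, Finset.sum_mul]

lemma sum_weight_mul_sub_weightedAvg (f : V → ℂ) {B : Finset V} (hB : 0 < ∑ x ∈ B, w x) :
    ∑ x ∈ B, (w x : ℂ) * (f x - weightedAvg w f B) = 0 := by
  rw [sum_weight_mul_sub f hB, sub_self, mul_zero]

lemma norm_weightedAvg_sub_le (hw : ∀ x, 0 ≤ w x) (f : V → ℂ) {B : Finset V}
    (hB : 0 < ∑ x ∈ B, w x) (c : ℂ) :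
    (∑ x ∈ B, w x) * ‖weightedAvg w f B - c‖ ≤ ∑ x ∈ B, w x * ‖f x - c‖ := by
  have h := congrArg norm (sum_weight_mul_sub f hB c)
  rw [norm_mul, Complex.norm_real, Real.norm_of_nonneg hB.le] at h
  rw [← h]
  refine (norm_sum_le _ _).trans (Finset.sum_le_sum fun x _ => ?_)
  rw [norm_mul, Complex.norm_real, Real.norm_of_nonneg (hw x)]

/-- The oscillation about the average is at most twice the oscillation about any constant. -/
lemma sum_norm_sub_weightedAvg_le (hw : ∀ x, 0 ≤ w x) (f : V → ℂ) {B : Finset V}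
    (hB : 0 < ∑ x ∈ B, w x) (c : ℂ) :
    ∑ x ∈ B, w x * ‖f x - weightedAvg w f B‖ ≤ 2 * ∑ x ∈ B, w x * ‖f x - c‖ := by
  have h : ∑ x ∈ B, w x * ‖f x - weightedAvg w f B‖ ≤
      ∑ x ∈ B, (w x * ‖f x - c‖ + w x * ‖weightedAvg w f B - c‖) := by
    refine Finset.sum_le_sum fun x _ => ?_
    rw [← mul_add]
    refine mul_le_mul_of_nonneg_left ?_ (hw x)
    rw [show f x - weightedAvg w f B = (f x - c) - (weightedAvg w f B - c) by ring]
    exact norm_sub_le _ _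
  rw [Finset.sum_add_distrib, ← Finset.sum_mul] at h
  linarith [norm_weightedAvg_sub_le hw f hB c]

/-- A family of finite sets each of which is a singleton or splits into strictly smaller members of
the family of comparable mass. -/
structure IsSplitting (w : V → ℝ) (𝒬 : Finset V → Prop) (D : ℝ) : Prop where
  pos : ∀ B, 𝒬 B → 0 < ∑ x ∈ B, w x
  split : ∀ B, 𝒬 B → (∃ x, B = {x}) ∨ ∃ (ι : Type u) (P : Finset ι) (Q : ι → Finset V),
    (∀ g : V → ℝ, ∑ x ∈ B, g x = ∑ i ∈ P, ∑ x ∈ Q i, g x) ∧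
      ∀ i ∈ P, 𝒬 (Q i) ∧ Q i ⊂ B ∧ ∑ x ∈ B, w x ≤ D * ∑ x ∈ Q i, w x

/-- Split `B` repeatedly, and stop at a piece once the mean of `‖f - c‖` on it exceeds `t`. Single
vertices reached without stopping have `‖f - c‖ ≤ t`. On a stopped piece the mean is still at most
`D * t`, since its predecessor was not stopped, so its average is within `D * t` of `c` and the
assumed bound `A` applies. The total mass of the stopped pieces is controlled by the integral of `‖f
- c‖` divided by `t`. -/
lemma IsSplitting.sum_sq_le (hw : ∀ x, 0 ≤ w x) {𝒬 : Finset V → Prop} {D : ℝ} (hD : 1 ≤ D)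
    (hS : IsSplitting w 𝒬 D) (f : V → ℂ) (c : ℂ) {t A : ℝ} (ht : 0 < t) (hA : 0 ≤ A)
    (B : Finset V) : 𝒬 B → (∀ Q, 𝒬 Q → Q ⊂ B →
      ∑ x ∈ Q, w x * ‖f x - weightedAvg w f Q‖ ^ 2 ≤ A * ∑ x ∈ Q, w x) →
    ∑ x ∈ B, w x * ‖f x - c‖ ≤ t * ∑ x ∈ B, w x →
    ∑ x ∈ B, w x * ‖f x - c‖ ^ 2 ≤ (D * t) ^ 2 * ∑ x ∈ B, w x +
      2 * (A + (D * t) ^ 2) / t * ∑ x ∈ B, w x * ‖f x - c‖ := by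
  induction B using Finset.strongInduction with
  | H B ih =>
  intro hB hsub havg
  have hDt : 0 ≤ D * t := by positivity
  rcases hS.split B hB with ⟨x, rfl⟩ | ⟨ι, P, Q, hsum, hQ⟩
  · have hx := hS.pos _ hB
    simp only [Finset.sum_singleton] at havg hx ⊢
    have h1 : ‖f x - c‖ ≤ t := by
      rw [mul_comm] at havg
      exact le_of_mul_le_mul_right havg hx
    have h2 : ‖f x - c‖ ^ 2 ≤ (D * t) ^ 2 := by
      refine pow_le_pow_left₀ (norm_nonneg _) (h1.trans ?_) 2
      nlinarith
    have h3 : 0 ≤ 2 * (A + (D * t) ^ 2) / t * (w x * ‖f x - c‖) := by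
      have := norm_nonneg (f x - c)
      positivity
    nlinarith
  · rw [hsum, hsum, hsum, Finset.mul_sum, Finset.mul_sum, ← Finset.sum_add_distrib]
    refine Finset.sum_le_sum fun i hi => ?_
    obtain ⟨hQi, hss, hDQ⟩ := hQ i hi
    have hpos := hS.pos _ hQi
    rcases le_or_gt (∑ x ∈ Q i, w x * ‖f x - c‖) (t * ∑ x ∈ Q i, w x) with h | h
    · exact ih _ hss hQi (fun R hR hR' => hsub R hR (hR'.trans hss)) h
    · have h1 : ∑ x ∈ Q i, w x * ‖f x - c‖ ≤ D * t * ∑ x ∈ Q i, w x := by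
        calc ∑ x ∈ Q i, w x * ‖f x - c‖ ≤ ∑ x ∈ B, w x * ‖f x - c‖ :=
              Finset.sum_le_sum_of_subset_of_nonneg hss.1 fun x _ _ =>
                mul_nonneg (hw x) (norm_nonneg _)
          _ ≤ t * (D * ∑ x ∈ Q i, w x) := havg.trans (mul_le_mul_of_nonneg_left hDQ ht.le)
          _ = _ := by ring
      have h2 : ‖weightedAvg w f (Q i) - c‖ ≤ D * t := by
        have := (norm_weightedAvg_sub_le hw f hpos c).trans h1
        rw [mul_comm] at this
        exact le_of_mul_le_mul_right this hpos
      have h3 : ∑ x ∈ Q i, w x * ‖f x - c‖ ^ 2 ≤ ∑ x ∈ Q i,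
          (2 * (w x * ‖f x - weightedAvg w f (Q i)‖ ^ 2) + 2 * (D * t) ^ 2 * w x) := by
        refine Finset.sum_le_sum fun x _ => ?_
        have h4 : ‖f x - c‖ ≤ ‖f x - weightedAvg w f (Q i)‖ + D * t := by
          refine le_trans ?_ (add_le_add_right h2 _)
          rw [show f x - c = (f x - weightedAvg w f (Q i)) + (weightedAvg w f (Q i) - c) by ring]
          exact norm_add_le _ _
        have h5 := pow_le_pow_left₀ (norm_nonneg _) h4 2
        have h6 : ‖f x - c‖ ^ 2 ≤ 2 * ‖f x - weightedAvg w f (Q i)‖ ^ 2 + 2 * (D * t) ^ 2 := by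
          nlinarith [sq_nonneg (‖f x - weightedAvg w f (Q i)‖ - D * t)]
        nlinarith [mul_le_mul_of_nonneg_left h6 (hw x)]
      rw [Finset.sum_add_distrib, ← Finset.mul_sum, ← Finset.mul_sum] at h3
      have h7 := hsub _ hQi hss
      -- The stopping condition pays for the mass of the piece with the integral of `‖f - c‖` over
      -- it.
      have h8 : 2 * (A + (D * t) ^ 2) * ∑ x ∈ Q i, w x ≤
          2 * (A + (D * t) ^ 2) / t * ∑ x ∈ Q i, w x * ‖f x - c‖ := by
        rw [div_mul_eq_mul_div, le_div_iff₀ ht, mul_assoc]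
        refine mul_le_mul_of_nonneg_left ?_ (by positivity)
        linarith
      have h9 : 0 ≤ (D * t) ^ 2 * ∑ x ∈ Q i, w x := by positivity
      linarith

/-- The `L²` form of the John–Nirenberg inequality along a splitting family. -/
lemma IsSplitting.john_nirenberg (hw : ∀ x, 0 ≤ w x) {𝒬 : Finset V → Prop} {D : ℝ} (hD : 1 ≤ D)
    (hS : IsSplitting w 𝒬 D) (f : V → ℂ) {K : ℝ} (hK : 0 < K)
    (hosc : ∀ B, 𝒬 B → ∑ x ∈ B, w x * ‖f x - weightedAvg w f B‖ ≤ K * ∑ x ∈ B, w x)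
    (B : Finset V) : 𝒬 B →
    ∑ x ∈ B, w x * ‖f x - weightedAvg w f B‖ ^ 2 ≤ 48 * (D * K) ^ 2 * ∑ x ∈ B, w x := by
  induction B using Finset.strongInduction with
  | H B ih =>
  intro hB
  have hpos := hS.pos B hB
  -- With `t = 4 * K` the bound `A` returns with coefficient 1/2. In units of `(D * K) ^ 2` the
  -- estimate is `16 + 2 * (A + 16) / 4`, whose fixed point is 48, so the induction closes.
  have h1 := hS.sum_sq_le hw hD f (weightedAvg w f B) (t := 4 * K) (A := 48 * (D * K) ^ 2)
    (by positivity) (by positivity) B hB (fun Q hQ hQB => ih Q hQB hQ)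
    ((hosc B hB).trans (by nlinarith))
  refine h1.trans ?_
  have h2 : 2 * (48 * (D * K) ^ 2 + (D * (4 * K)) ^ 2) / (4 * K) *
      ∑ x ∈ B, w x * ‖f x - weightedAvg w f B‖ ≤
      2 * (48 * (D * K) ^ 2 + (D * (4 * K)) ^ 2) / (4 * K) * (K * ∑ x ∈ B, w x) :=
    mul_le_mul_of_nonneg_left (hosc B hB) (by positivity)
  refine (add_le_add_right h2 _).trans (le_of_eq ?_)
  field_simp
  ring

end JohnNirenberg

namespace WeightedTree

/-! ### Splitting boxes, and John–Nirenberg on Calderón–Zygmund sets. -/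

section Boxes

universe u

variable {V : Type u} {m : ℕ} (T : WeightedTree V m)

/-- The boxes used in the stopping argument: the depths range over an interval `[a, b)` with
`2a ≤ b ≤ 8a`, or over a short interval starting at the root. -/
def IsGoodBox (B : Finset V) : Prop :=
  ∃ (r : V) (a b : ℕ), B = T.box r a b ∧ (1 ≤ a ∧ 2 * a ≤ b ∧ b ≤ 8 * a ∨ a = 0 ∧ 1 ≤ b ∧ b ≤ 7)

lemma ssubset_of_sum_weight_lt {A B : Finset V} (h : A ⊆ B)
    (hlt : ∑ x ∈ A, T.weight x < ∑ x ∈ B, T.weight x) : A ⊂ B :=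
  Finset.ssubset_iff_subset_ne.2 ⟨h, fun e => by simp [e] at hlt⟩

lemma isSplitting_isGoodBox : IsSplitting T.weight T.IsGoodBox (7 * m) := by
  have hm : (2 : ℝ) ≤ m := by exact_mod_cast T.two_le
  refine ⟨?_, ?_⟩
  · rintro B ⟨r, a, b, rfl, h⟩
    have hab : a < b := by omega
    rw [T.sum_weight_box r hab.le]
    exact mul_pos (sub_pos.2 (by exact_mod_cast hab)) (T.weight_pos r)
  · rintro B ⟨r, a, b, rfl, h⟩
    -- There are two ways to split: cut the depth interval at `c` under the same root, or pass to
    -- the children of the root, which shifts the interval down by one.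
    have cut : ∀ c, a < c → c < b → T.IsGoodBox (T.box r a c) → T.IsGoodBox (T.box r c b) →
        b - a ≤ 7 * (c - a) → b - a ≤ 7 * (b - c) →
        ∃ (ι : Type u) (P : Finset ι) (Q : ι → Finset V),
        (∀ g : V → ℝ, ∑ x ∈ T.box r a b, g x = ∑ i ∈ P, ∑ x ∈ Q i, g x) ∧
        ∀ i ∈ P, T.IsGoodBox (Q i) ∧ Q i ⊂ T.box r a b ∧
          ∑ x ∈ T.box r a b, T.weight x ≤ 7 * m * ∑ x ∈ Q i, T.weight x := by
      intro c hac hcb h1 h2 h3 h4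
      have hac' : (a : ℝ) < c := by exact_mod_cast hac
      have hcb' : (c : ℝ) < b := by exact_mod_cast hcb
      have h3' : (b : ℝ) - a ≤ 7 * (c - a) := by
        have : b + 6 * a ≤ 7 * c := by omega
        have : (b : ℝ) + 6 * a ≤ 7 * c := by exact_mod_cast this
        linarith
      have h4' : (b : ℝ) - a ≤ 7 * (b - c) := by
        have : 7 * c ≤ 6 * b + a := by omega
        have : 7 * (c : ℝ) ≤ 6 * b + a := by exact_mod_cast this
        linarith
      have hwr := T.weight_pos r
      refine ⟨ULift Bool, Finset.univ, fun i => if i.down then T.box r a c else T.box r c b,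
        fun g => ?_, ?_⟩
      · rw [← Equiv.ulift.symm.sum_comp]
        simp [T.sum_box_consecutive g r hac.le hcb.le]
      · rintro ⟨_ | _⟩ -
        · have hlt : ∑ x ∈ T.box r c b, T.weight x < ∑ x ∈ T.box r a b, T.weight x := by
            rw [T.sum_weight_box r hcb.le, T.sum_weight_box r (hac.trans hcb).le]
            exact mul_lt_mul_of_pos_right (by linarith) hwr
          refine ⟨by simpa using h2, ?_, ?_⟩
          · simpa using T.ssubset_of_sum_weight_lt (T.box_mono hac.le le_rfl) hlt
          · simp only [Bool.false_eq_true, if_false]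
            rw [T.sum_weight_box r hcb.le, T.sum_weight_box r (hac.trans hcb).le, ← mul_assoc]
            refine mul_le_mul_of_nonneg_right ?_ hwr.le
            nlinarith
        · have hlt : ∑ x ∈ T.box r a c, T.weight x < ∑ x ∈ T.box r a b, T.weight x := by
            rw [T.sum_weight_box r hac.le, T.sum_weight_box r (hac.trans hcb).le]
            exact mul_lt_mul_of_pos_right (by linarith) hwr
          refine ⟨by simpa using h1, ?_, ?_⟩
          · simpa using T.ssubset_of_sum_weight_lt (T.box_mono le_rfl hcb.le) hlt
          · simp only [if_true]
            rw [T.sum_weight_box r hac.le, T.sum_weight_box r (hac.trans hcb).le, ← mul_assoc]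
            refine mul_le_mul_of_nonneg_right ?_ hwr.le
            nlinarith
    by_cases h0 : a = 0
    · subst h0
      by_cases h1 : b = 1
      · subst h1
        exact Or.inl ⟨r, T.box_zero_one r⟩
      · exact Or.inr (cut 1 (by omega) (by omega) ⟨r, 0, 1, rfl, by omega⟩
          ⟨r, 1, b, rfl, by omega⟩ (by omega) (by omega))
    -- This is when the interval shifted to `[a - 1, b - 1)` is still admissible: either it now
    -- starts at the root with `b - 1 ≤ 7`, or `b - 1 ≤ 8 * (a - 1)`. The mass drops by the factor
    -- m.
    by_cases h1 : a = 1 ∨ b + 7 ≤ 8 * a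
    · right
      obtain ⟨a, rfl⟩ : ∃ a', a = a' + 1 := ⟨a - 1, by omega⟩
      obtain ⟨b, rfl⟩ : ∃ b', b = b' + 1 := ⟨b - 1, by omega⟩
      have hab : a < b := by omega
      have hab' : (0 : ℝ) < b - a := sub_pos.2 (by exact_mod_cast hab)
      refine ⟨V, T.children r, fun s => T.box s a b, fun g => T.sum_box_children g r a b, ?_⟩
      intro s hs
      rw [T.mem_children] at hs
      subst hs
      have hws := T.weight_pos s
      refine ⟨⟨s, a, b, rfl, by omega⟩, T.ssubset_of_sum_weight_lt (T.box_subset_parent s a b) ?_,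
        ?_⟩ <;>
      rw [T.sum_weight_box s hab.le, T.sum_weight_box _ (by omega), weight_parent] <;>
      push_cast
      · have : 0 < (b - a) * T.weight s := mul_pos hab' hws
        nlinarith
      · have : 0 < m * ((b - a) * T.weight s) := mul_pos (by linarith) (mul_pos hab' hws)
        linarith
    -- Here `a ≥ 2` and `b` is within 6 of `8 * a`, so a cut at `2 * a` leaves two admissible
    -- intervals of comparable length.
    · exact Or.inr (cut (2 * a) (by omega) (by omega) ⟨r, _, _, rfl, by omega⟩
        ⟨r, _, _, rfl, by omega⟩ (by omega) (by omega))

lemma exists_isCZ_of_isGoodBox {B : Finset V} (hB : T.IsGoodBox B) :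
    ∃ R : Finset V, T.IsCZ (R : Set V) ∧ B ⊆ R ∧
      ∑ x ∈ R, T.weight x ≤ 7 * m * ∑ x ∈ B, T.weight x := by
  have hm : (2 : ℝ) ≤ m := by exact_mod_cast T.two_le
  obtain ⟨r, a, b, rfl, ⟨h1, h2, h3⟩ | ⟨rfl, h1, h2⟩⟩ := hB
  -- The choice `h = 2 * a` gives depths `[a, 8a)`, which have length `7 * a ≤ 7 * (b - a)`.
  · refine ⟨_, T.isCZ_box r (h := 2 * a) (by omega), T.box_mono (by omega) (by omega), ?_⟩
    rw [T.sum_weight_box _ (by omega), T.sum_weight_box _ (by omega), ← mul_assoc (7 * (m : ℝ))]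
    refine mul_le_mul_of_nonneg_right ?_ (T.weight_pos r).le
    have h4 : (2 * a + 1) / 2 = a := by omega
    have h2' : 2 * (a : ℝ) ≤ b := by exact_mod_cast h2
    have ha : (0 : ℝ) ≤ a := by positivity
    rw [h4]
    push_cast
    nlinarith
  -- Calderón–Zygmund boxes do not contain their root, so a box starting at the root is moved one
  -- generation up, into depths `[1, 8)` below the parent; this costs the factor m.
  · refine ⟨_, T.isCZ_box (T.parent r) (h := 2) (by omega),
      (T.box_subset_parent r 0 b).trans (T.box_mono (by omega) (by omega)), ?_⟩
    rw [T.sum_weight_box _ (by omega), T.sum_weight_box _ (by omega), weight_parent]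
    have h1' : 1 ≤ (b : ℝ) := by exact_mod_cast h1
    have := mul_pos T.m_pos (T.weight_pos r)
    norm_num
    nlinarith

lemma isGoodBox_of_isCZ {R : Finset V} (hR : T.IsCZ (R : Set V)) : T.IsGoodBox R := by
  rcases T.isCZ_iff.1 hR with ⟨r, h⟩ | ⟨r, h, hh, h'⟩
  · refine ⟨r, 0, 1, ?_, by omega⟩
    rw [box_zero_one]
    exact_mod_cast h
  · exact ⟨r, _, _, by exact_mod_cast h', by omega⟩

/-- The John–Nirenberg inequality for Calderón–Zygmund sets: bounded mean oscillation implies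
bounded mean square oscillation. -/
lemma sum_sq_osc_le (f : V → ℂ) {K : ℝ} (hK : 0 < K)
    (hosc : ∀ R : Finset V, T.IsCZ (R : Set V) →
      ∑ x ∈ R, T.weight x * ‖f x - weightedAvg T.weight f R‖ ≤ K * ∑ x ∈ R, T.weight x)
    {R : Finset V} (hR : T.IsCZ (R : Set V)) :
    ∑ x ∈ R, T.weight x * ‖f x - weightedAvg T.weight f R‖ ^ 2 ≤
      48 * (7 * m * (2 * (K * (7 * m)))) ^ 2 * ∑ x ∈ R, T.weight x := by
  have hm : (2 : ℝ) ≤ m := by exact_mod_cast T.two_le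
  have hw : ∀ x, 0 ≤ T.weight x := fun x => (T.weight_pos x).le
  -- The oscillation on a good box is compared with that on an enclosing Calderón–Zygmund set: `7 *
  -- m` is the ratio of masses, and 2 the cost of changing the average.
  refine T.isSplitting_isGoodBox.john_nirenberg hw (by linarith) f (by positivity) ?_ R
    (T.isGoodBox_of_isCZ hR)
  intro B hB
  obtain ⟨S, hS, hBS, hle⟩ := T.exists_isCZ_of_isGoodBox hB
  refine (sum_norm_sub_weightedAvg_le hw f (T.isSplitting_isGoodBox.pos B hB)
    (weightedAvg T.weight f S)).trans ?_
  rw [mul_assoc]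
  refine mul_le_mul_of_nonneg_left ?_ two_pos.le
  calc _ ≤ ∑ x ∈ S, T.weight x * ‖f x - weightedAvg T.weight f S‖ :=
        Finset.sum_le_sum_of_subset_of_nonneg hBS fun x _ _ => mul_nonneg (hw x) (norm_nonneg _)
    _ ≤ K * (7 * m * ∑ x ∈ B, T.weight x) :=
        (hosc S hS).trans (mul_le_mul_of_nonneg_left hle hK.le)
    _ = _ := by ring

end Boxes

end WeightedTree

namespace WeightedTree

/-! ### Integrals and norms for `μ` as weighted sums. -/

section Measure

variable {V : Type*} {m : ℕ} [MeasurableSpace V] [DiscreteMeasurableSpace V] (T : WeightedTree V m)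

lemma lintegral_mu (f : V → ℝ≥0∞) :
    ∫⁻ x, f x ∂T.μ = ∑' x, ENNReal.ofReal (T.weight x) * f x := by
  rw [μ, lintegral_sum_measure]
  simp [lintegral_smul_measure, weight]

lemma mu_singleton (x : V) : T.μ {x} = ENNReal.ofReal (T.weight x) := by
  classical
  rw [← lintegral_indicator_one (MeasurableSet.singleton x), lintegral_mu,
    tsum_eq_single x fun y hy => by simp [hy]]
  simp

lemma mu_finset (B : Finset V) : T.μ B = ENNReal.ofReal (∑ x ∈ B, T.weight x) := by
  rw [← sum_measure_singleton, ENNReal.ofReal_sum_of_nonneg fun x _ => (T.weight_pos x).le]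
  simp only [mu_singleton]

lemma mu_real_finset (B : Finset V) : T.μ.real B = ∑ x ∈ B, T.weight x := by
  rw [Measure.real, mu_finset, ENNReal.toReal_ofReal
    (Finset.sum_nonneg fun x _ => (T.weight_pos x).le)]

lemma integrableOn_finset {E : Type*} [NormedAddCommGroup E] (f : V → E) (B : Finset V) :
    IntegrableOn f B T.μ := by
  classical
  induction B using Finset.induction_on with
  | empty => simp
  | insert x B _ ih =>
    rw [Finset.coe_insert, Set.insert_eq]
    refine IntegrableOn.union ?_ ih
    rw [integrableOn_singleton_iff, mu_singleton]
    exact Or.inr ENNReal.ofReal_lt_top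

lemma setIntegral_finset {E : Type*} [NormedAddCommGroup E] [NormedSpace ℝ E] [CompleteSpace E]
    (f : V → E) (B : Finset V) : ∫ x in B, f x ∂T.μ = ∑ x ∈ B, T.weight x • f x := by
  rw [MeasureTheory.setIntegral_finset _ (T.integrableOn_finset f B)]
  refine Finset.sum_congr rfl fun x _ => ?_
  rw [Measure.real, mu_singleton, ENNReal.toReal_ofReal (T.weight_pos x).le]

lemma integral_eq_sum {f : V → ℂ} {B : Finset V} (h : ∀ x, x ∉ B → f x = 0) :
    ∫ x, f x ∂T.μ = ∑ x ∈ B, (T.weight x : ℂ) * f x := by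
  rw [← setIntegral_eq_integral_of_forall_compl_eq_zero (s := (B : Set V)) fun x hx => h x hx,
    setIntegral_finset]
  simp

lemma osc_finset (f : V → ℂ) (B : Finset V) :
    T.osc f B = (∑ x ∈ B, T.weight x)⁻¹ *
      ∑ x ∈ B, T.weight x * ‖f x - weightedAvg T.weight f B‖ := by
  rw [osc, setAverage_eq, setIntegral_finset, mu_real_finset]
  have : ⨍ y in (B : Set V), f y ∂T.μ = weightedAvg T.weight f B := by
    rw [setAverage_eq, setIntegral_finset, mu_real_finset, weightedAvg]
    simp
  simp only [this, smul_eq_mul]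

lemma eLpNorm_one_mu (f : V → ℂ) :
    eLpNorm f 1 T.μ = ∑' x, ENNReal.ofReal (T.weight x) * ‖f x‖ₑ := by
  rw [eLpNorm_one_eq_lintegral_enorm, lintegral_mu]

lemma ofReal_mul_enorm (x : V) (z : ℂ) :
    ENNReal.ofReal (T.weight x) * ‖z‖ₑ = ENNReal.ofReal (T.weight x * ‖z‖) := by
  rw [← ofReal_norm, ENNReal.ofReal_mul (T.weight_pos x).le]

lemma eLpNorm_one_eq_sum {f : V → ℂ} {B : Finset V} (h : ∀ x, x ∉ B → f x = 0) :
    eLpNorm f 1 T.μ = ENNReal.ofReal (∑ x ∈ B, T.weight x * ‖f x‖) := by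
  rw [eLpNorm_one_mu, tsum_eq_sum (s := B) fun x hx => by simp [h x hx],
    ENNReal.ofReal_sum_of_nonneg fun x _ => mul_nonneg (T.weight_pos x).le (norm_nonneg _)]
  simp only [ofReal_mul_enorm]

lemma eLpNorm_two_eq_sum {f : V → ℂ} {B : Finset V} (h : ∀ x, x ∉ B → f x = 0) :
    eLpNorm f 2 T.μ = ENNReal.ofReal ((∑ x ∈ B, T.weight x * ‖f x‖ ^ 2) ^ (1 / 2 : ℝ)) := by
  have hpos : ∀ x ∈ B, 0 ≤ T.weight x * ‖f x‖ ^ 2 := fun x _ =>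
    mul_nonneg (T.weight_pos x).le (sq_nonneg _)
  rw [eLpNorm_eq_lintegral_rpow_enorm_toReal two_ne_zero ENNReal.ofNat_ne_top, lintegral_mu,
    tsum_eq_sum (s := B) fun x hx => by simp [h x hx],
    ← ENNReal.ofReal_rpow_of_nonneg (Finset.sum_nonneg hpos) (by norm_num),
    ENNReal.ofReal_sum_of_nonneg hpos]
  simp only [ENNReal.toReal_ofNat]
  congr 1
  refine Finset.sum_congr rfl fun x _ => ?_
  rw [ENNReal.ofReal_mul (T.weight_pos x).le, ENNReal.ofReal_pow (norm_nonneg _), ofReal_norm]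
  congr 1
  exact_mod_cast ENNReal.rpow_natCast _ 2

lemma enorm_mul_le_eLpNorm_one (f : V → ℂ) (x : V) :
    ENNReal.ofReal (T.weight x) * ‖f x‖ₑ ≤ eLpNorm f 1 T.μ := by
  rw [eLpNorm_one_mu]
  exact ENNReal.le_tsum x

lemma weight_mul_norm_le {f : V → ℂ} (hf : eLpNorm f 1 T.μ ≤ 1) (x : V) :
    T.weight x * ‖f x‖ ≤ 1 := by
  have h := (T.enorm_mul_le_eLpNorm_one f x).trans hf
  rw [ofReal_mul_enorm] at h
  exact ENNReal.ofReal_le_one.1 h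

lemma eLpNorm_top_le_iff {f : V → ℂ} {C : ℝ≥0∞} :
    eLpNorm f ∞ T.μ ≤ C ↔ ∀ x, ‖f x‖ₑ ≤ C := by
  rw [eLpNorm_exponent_top]
  constructor
  · intro h x
    have h1 : ∀ᵐ x ∂T.μ, ‖f x‖ₑ ≤ C :=
      (ae_le_eLpNormEssSup (f := f)).mono fun x hx => hx.trans h
    by_contra hx
    exact mu_singleton_ne_zero (T := T) x (measure_mono_null (by rintro _ rfl; exact hx) h1)
  · exact fun h => eLpNormEssSup_le_of_ae_enorm_bound (ae_of_all _ h)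

end Measure

/-! ### Atoms, atomic series, and reduction of the comparison to single atoms. -/

section Atoms

variable {V : Type*} {m : ℕ} [MeasurableSpace V] [DiscreteMeasurableSpace V] {T : WeightedTree V m}

lemma isAtom_top_iff {a : V → ℂ} : T.IsAtom ∞ a ↔ ∃ B : Finset V, T.IsCZ (B : Set V) ∧
    0 < ∑ x ∈ B, T.weight x ∧ (∀ x, x ∉ B → a x = 0) ∧
    (∀ x, ‖a x‖ * ∑ x ∈ B, T.weight x ≤ 1) ∧ ∑ x ∈ B, (T.weight x : ℂ) * a x = 0 := by
  have key : ∀ B : Finset V, 0 < ∑ x ∈ B, T.weight x →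
      (eLpNorm a ∞ T.μ ≤ T.μ B ^ (((∞ : ℝ≥0∞)⁻¹).toReal - 1) ↔
        ∀ x, ‖a x‖ * ∑ x ∈ B, T.weight x ≤ 1) := by
    intro B hB
    rw [eLpNorm_top_le_iff]
    refine forall_congr' fun x => ?_
    rw [ENNReal.inv_top, ENNReal.toReal_zero, zero_sub, ENNReal.rpow_neg_one, mu_finset,
      ← ENNReal.ofReal_inv_of_pos hB, ← ofReal_norm,
      ENNReal.ofReal_le_ofReal_iff (inv_nonneg.2 hB.le), ← one_div, le_div_iff₀ hB]
  constructor
  · rintro ⟨R, hR, hs, hn, hi⟩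
    obtain ⟨B, rfl, hB⟩ := hR.exists_finset
    exact ⟨B, hR, hB, hs, (key B hB).1 hn, by rw [← T.integral_eq_sum hs, hi]⟩
  · rintro ⟨B, hR, hB, hs, hn, hi⟩
    exact ⟨B, hR, hs, (key B hB).2 hn, by rw [T.integral_eq_sum hs, hi]⟩

/-- The size condition is squared and multiplied by the mass of the set, which removes roots and
inverses. -/
lemma isAtom_two_iff {a : V → ℂ} : T.IsAtom 2 a ↔ ∃ B : Finset V, T.IsCZ (B : Set V) ∧
    0 < ∑ x ∈ B, T.weight x ∧ (∀ x, x ∉ B → a x = 0) ∧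
    (∑ x ∈ B, T.weight x * ‖a x‖ ^ 2) * ∑ x ∈ B, T.weight x ≤ 1 ∧
    ∑ x ∈ B, (T.weight x : ℂ) * a x = 0 := by
  have key : ∀ B : Finset V, 0 < ∑ x ∈ B, T.weight x → (∀ x, x ∉ B → a x = 0) →
      (eLpNorm a 2 T.μ ≤ T.μ B ^ (((2 : ℝ≥0∞)⁻¹).toReal - 1) ↔
        (∑ x ∈ B, T.weight x * ‖a x‖ ^ 2) * ∑ x ∈ B, T.weight x ≤ 1) := by
    intro B hB hs
    have hpos : 0 ≤ ∑ x ∈ B, T.weight x * ‖a x‖ ^ 2 :=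
      Finset.sum_nonneg fun x _ => mul_nonneg (T.weight_pos x).le (sq_nonneg _)
    rw [eLpNorm_two_eq_sum T hs, mu_finset, ENNReal.toReal_inv, ENNReal.toReal_ofNat,
      ENNReal.ofReal_rpow_of_pos hB, ENNReal.ofReal_le_ofReal_iff (by positivity),
      show (2⁻¹ - 1 : ℝ) = -(1 / 2) by norm_num, Real.rpow_neg hB.le, ← Real.inv_rpow hB.le,
      Real.rpow_le_rpow_iff hpos (inv_nonneg.2 hB.le) (by norm_num), ← one_div, le_div_iff₀ hB]
  constructor
  · rintro ⟨R, hR, hs, hn, hi⟩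
    obtain ⟨B, rfl, hB⟩ := hR.exists_finset
    exact ⟨B, hR, hB, hs, (key B hB hs).1 hn, by rw [← T.integral_eq_sum hs, hi]⟩
  · rintro ⟨B, hR, hB, hs, hn, hi⟩
    exact ⟨B, hR, hs, (key B hB hs).2 hn, by rw [T.integral_eq_sum hs, hi]⟩

lemma IsAtom.two_of_top {a : V → ℂ} (ha : T.IsAtom ∞ a) : T.IsAtom 2 a := by
  obtain ⟨B, hR, hB, hs, hn, hi⟩ := isAtom_top_iff.1 ha
  refine isAtom_two_iff.2 ⟨B, hR, hB, hs, ?_, hi⟩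
  have hle : ∀ x, ‖a x‖ ≤ (∑ x ∈ B, T.weight x)⁻¹ := fun x => by
    rw [← one_div, le_div_iff₀ hB]
    exact hn x
  calc (∑ x ∈ B, T.weight x * ‖a x‖ ^ 2) * ∑ x ∈ B, T.weight x
      ≤ (∑ x ∈ B, T.weight x * ((∑ x ∈ B, T.weight x)⁻¹) ^ 2) * ∑ x ∈ B, T.weight x := by
        refine mul_le_mul_of_nonneg_right (Finset.sum_le_sum fun x _ => ?_) hB.le
        exact mul_le_mul_of_nonneg_left (pow_le_pow_left₀ (norm_nonneg _) (hle x) 2)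
          (T.weight_pos x).le
    _ = 1 := by
        rw [← Finset.sum_mul]
        field_simp

/-- The Cauchy–Schwarz inequality for weighted finite sums. -/
lemma sq_sum_weight_mul_le (B : Finset V) (u v : V → ℝ) :
    (∑ x ∈ B, T.weight x * (u x * v x)) ^ 2 ≤
      (∑ x ∈ B, T.weight x * u x ^ 2) * ∑ x ∈ B, T.weight x * v x ^ 2 := by
  refine Finset.sum_sq_le_sum_mul_sum_of_sq_le_mul B
    (fun x _ => mul_nonneg (T.weight_pos x).le (sq_nonneg _))
    (fun x _ => mul_nonneg (T.weight_pos x).le (sq_nonneg _)) fun x _ => le_of_eq (by ring)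

lemma IsAtom.eLpNorm_one_le_of_two {a : V → ℂ} (ha : T.IsAtom 2 a) : eLpNorm a 1 T.μ ≤ 1 := by
  obtain ⟨B, hR, hB, hs, hn, hi⟩ := isAtom_two_iff.1 ha
  rw [T.eLpNorm_one_eq_sum hs, ENNReal.ofReal_le_one]
  have h := sq_sum_weight_mul_le (T := T) B (fun x => ‖a x‖) fun _ => 1
  simp only [mul_one, one_pow] at h
  exact le_of_sq_le_sq (by simpa using h.trans hn) zero_le_one

lemma isDecomp_single {p : ℝ≥0∞} {a : V → ℂ} (ha : T.IsAtom p a) (k : ℂ) :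
    T.IsDecomp p (k • a) (fun j => if j = 0 then k else 0) fun _ => a := by
  refine ⟨fun _ => ha, summable_of_ne_finset_zero (s := {0}) fun j hj => ?_, ?_⟩
  · simp at hj
    simp [hj]
  · refine tendsto_atTop_of_eventually_const (i₀ := 1) fun n hn => ?_
    have : 0 < n := hn
    simp [this]

lemma hardyNorm_smul_atom_le {p : ℝ≥0∞} {a : V → ℂ} (ha : T.IsAtom p a) (k : ℂ) :
    T.hardyNorm p (k • a) ≤ ‖k‖ := by
  refine (isDecomp_single ha k).hardyNorm_le.trans (le_of_eq ?_)
  rw [tsum_eq_single 0 fun j hj => by simp [hj]]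
  simp

/-- Convergence of an atomic series in `L¹` is the same as pointwise convergence. -/
lemma isDecomp_iff {p : ℝ≥0∞} (hp : ∀ a, T.IsAtom p a → eLpNorm a 1 T.μ ≤ 1) {g : V → ℂ}
    {c : ℕ → ℂ} {a : ℕ → V → ℂ} : T.IsDecomp p g c a ↔ (∀ j, T.IsAtom p (a j)) ∧
      (Summable fun j => ‖c j‖) ∧ ∀ x, HasSum (fun j => c j * a j x) (g x) := by
  have hsum : (∀ j, T.IsAtom p (a j)) → (Summable fun j => ‖c j‖) → ∀ x,
      Summable fun j => c j * a j x := by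
    intro ha hc x
    -- A function of L¹ norm at most 1 has modulus at most `(weight x)⁻¹` at `x`, so the atomic
    -- series converges absolutely at every vertex.
    refine Summable.of_norm_bounded (hc.mul_right (T.weight x)⁻¹) fun j => ?_
    rw [norm_mul]
    refine mul_le_mul_of_nonneg_left ?_ (norm_nonneg _)
    rw [← one_div, le_div_iff₀ (T.weight_pos x), mul_comm]
    exact T.weight_mul_norm_le (hp _ (ha j)) x
  constructor
  · intro h
    refine ⟨h.atom, h.summable, fun x => ?_⟩
    have h1 := hsum h.atom h.summable x
    have h2 : Tendsto (fun n => ENNReal.ofReal (T.weight x) *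
        ‖g x - ∑ j ∈ Finset.range n, c j * a j x‖ₑ) atTop (𝓝 0) :=
      tendsto_of_tendsto_of_tendsto_of_le_of_le tendsto_const_nhds h.tendsto
        (fun _ => zero_le) fun n => T.enorm_mul_le_eLpNorm_one
          (fun x => g x - ∑ j ∈ Finset.range n, c j * a j x) x
    have h3 : Tendsto (fun n => ENNReal.ofReal (T.weight x) *
        ‖g x - ∑ j ∈ Finset.range n, c j * a j x‖ₑ) atTop
          (𝓝 (ENNReal.ofReal (T.weight x) * ‖g x - ∑' j, c j * a j x‖ₑ)) :=
      ENNReal.Tendsto.const_mul ((tendsto_const_nhds.sub h1.hasSum.tendsto_sum_nat).enorm)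
        (Or.inr ENNReal.ofReal_ne_top)
    have h4 := tendsto_nhds_unique h2 h3
    have h5 : g x - ∑' j, c j * a j x = 0 := by
      simpa [(T.weight_pos x).not_ge] using h4.symm
    rw [sub_eq_zero.1 h5]
    exact h1.hasSum
  · rintro ⟨ha, hc, hg⟩
    refine ⟨ha, hc, ?_⟩
    have hc' : ∑' j, ‖c j‖ₑ ≠ ∞ := by
      simp only [← ofReal_norm]
      rw [← ENNReal.ofReal_tsum_of_nonneg (fun _ => norm_nonneg _) hc]
      exact ENNReal.ofReal_ne_top
    refine tendsto_of_tendsto_of_tendsto_of_le_of_le tendsto_const_nhds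
      (ENNReal.tendsto_sum_nat_add (fun j => ‖c j‖ₑ) hc') (fun _ => zero_le) fun n => ?_
    have h1 : ∀ x, ‖g x - ∑ j ∈ Finset.range n, c j * a j x‖ₑ ≤
        ∑' j, ‖c (j + n)‖ₑ * ‖a (j + n) x‖ₑ := by
      intro x
      rw [← (hg x).tsum_eq, ← (hg x).summable.sum_add_tsum_nat_add n, add_sub_cancel_left]
      refine enorm_tsum_le_tsum_enorm.trans (le_of_eq ?_)
      simp only [enorm_mul]
    calc _ ≤ ∑' x, ∑' j, ENNReal.ofReal (T.weight x) * (‖c (j + n)‖ₑ * ‖a (j + n) x‖ₑ) := by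
          rw [eLpNorm_one_mu]
          refine ENNReal.tsum_le_tsum fun x => ?_
          rw [ENNReal.tsum_mul_left]
          exact mul_le_mul_right (h1 x) _
      _ = ∑' j, ‖c (j + n)‖ₑ * eLpNorm (a (j + n)) 1 T.μ := by
          rw [ENNReal.tsum_comm]
          refine tsum_congr fun j => ?_
          rw [eLpNorm_one_mu, ← ENNReal.tsum_mul_left]
          exact tsum_congr fun x => by ring
      _ ≤ ∑' j, ‖c (j + n)‖ₑ := by
          refine ENNReal.tsum_le_tsum fun j => ?_
          exact (mul_le_mul_right (hp _ (ha _)) _).trans (by rw [mul_one])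

lemma isDecomp_top_iff {g : V → ℂ} {c : ℕ → ℂ} {a : ℕ → V → ℂ} :
    T.IsDecomp ∞ g c a ↔ (∀ j, T.IsAtom ∞ (a j)) ∧
      (Summable fun j => ‖c j‖) ∧ ∀ x, HasSum (fun j => c j * a j x) (g x) :=
  isDecomp_iff fun _ ha => ha.eLpNorm_one_le

lemma isDecomp_two_iff {g : V → ℂ} {c : ℕ → ℂ} {a : ℕ → V → ℂ} :
    T.IsDecomp 2 g c a ↔ (∀ j, T.IsAtom 2 (a j)) ∧
      (Summable fun j => ‖c j‖) ∧ ∀ x, HasSum (fun j => c j * a j x) (g x) :=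
  isDecomp_iff fun _ ha => ha.eLpNorm_one_le_of_two

/-- If each `(1, 2)`-atom has a decomposition into `(1, ∞)`-atoms with coefficients of total mass
at most `C`, then decompositions into `(1, 2)`-atoms can be refined. -/
lemma IsDecomp.exists_top_of_two {C : ℝ}
    (hC : ∀ a, T.IsAtom 2 a → ∃ d b, T.IsDecomp ∞ a d b ∧ ∑' j, ‖d j‖ ≤ C) {g : V → ℂ} {c : ℕ → ℂ}
    {a : ℕ → V → ℂ} (h : T.IsDecomp 2 g c a) :
    ∃ d b, T.IsDecomp ∞ g d b ∧ ∑' j, ‖d j‖ ≤ C * ∑' j, ‖c j‖ := by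
  obtain ⟨ha, hc, hg⟩ := isDecomp_two_iff.1 h
  choose d b hd hdC using fun j => hC (a j) (ha j)
  have hd' := fun j => isDecomp_top_iff.1 (hd j)
  have hs : Summable fun q : ℕ × ℕ => ‖c q.1 * d q.1 q.2‖ := by
    rw [summable_prod_of_nonneg fun q => norm_nonneg _]
    simp only [norm_mul, tsum_mul_left]
    refine ⟨fun j => (hd' j).2.1.mul_left _, ?_⟩
    exact Summable.of_nonneg_of_le
      (fun j => mul_nonneg (norm_nonneg _) (tsum_nonneg fun _ => norm_nonneg _))
      (fun j => mul_le_mul_of_nonneg_left (hdC j) (norm_nonneg _)) (hc.mul_right C)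
  have hle : ∑' q : ℕ × ℕ, ‖c q.1 * d q.1 q.2‖ ≤ C * ∑' j, ‖c j‖ := by
    rw [hs.tsum_prod' fun j => hs.prod_factor j, mul_comm, ← tsum_mul_right]
    refine Summable.tsum_le_tsum (fun j => ?_) hs.prod (hc.mul_right C)
    simp only [norm_mul, tsum_mul_left]
    exact mul_le_mul_of_nonneg_left (hdC j) (norm_nonneg _)
  -- The double series converges absolutely, so it may be enumerated as a single one.
  let e : ℕ ≃ ℕ × ℕ := Nat.pairEquiv.symm
  refine ⟨fun n => c (e n).1 * d (e n).1 (e n).2, fun n => b (e n).1 (e n).2,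
    isDecomp_top_iff.2 ⟨fun n => (hd' _).1 _, (e.summable_iff (f := fun q : ℕ × ℕ =>
      ‖c q.1 * d q.1 q.2‖)).2 hs, fun x => ?_⟩, ?_⟩
  · have hsx : Summable fun q : ℕ × ℕ => c q.1 * d q.1 q.2 * b q.1 q.2 x := by
      refine Summable.of_norm_bounded (hs.mul_right (T.weight x)⁻¹) fun q => ?_
      rw [norm_mul]
      refine mul_le_mul_of_nonneg_left ?_ (norm_nonneg _)
      rw [← one_div, le_div_iff₀ (T.weight_pos x), mul_comm]
      exact T.weight_mul_norm_le ((hd' _).1 _).eLpNorm_one_le x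
    have h1 : HasSum (fun q : ℕ × ℕ => c q.1 * d q.1 q.2 * b q.1 q.2 x) (g x) := by
      have h2 := hsx.hasSum.prod_fiberwise (g := fun j => c j * a j x) fun j => by
        simpa only [mul_assoc] using ((hd' j).2.2 x).mul_left (c j)
      rw [(hg x).unique h2]
      exact hsx.hasSum
    exact (e.hasSum_iff (f := fun q : ℕ × ℕ => c q.1 * d q.1 q.2 * b q.1 q.2 x)).2 h1
  · rw [e.tsum_eq fun q : ℕ × ℕ => ‖c q.1 * d q.1 q.2‖]
    exact hle

lemma IsDecomp.two_of_top {g : V → ℂ} {c : ℕ → ℂ} {a : ℕ → V → ℂ} (h : T.IsDecomp ∞ g c a) :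
    T.IsDecomp 2 g c a :=
  ⟨fun j => (h.atom j).two_of_top, h.summable, h.tendsto⟩

lemma exists_isComparisonConst {C : ℝ}
    (hC : ∀ a, T.IsAtom 2 a → ∃ d b, T.IsDecomp ∞ a d b ∧ ∑' j, ‖d j‖ ≤ C) (hC0 : 0 < C) :
    T.IsComparisonConst 2 C := by
  have heq : T.hardySubmodule 2 = T.hardySubmodule ∞ := by
    ext g
    constructor
    · rintro ⟨hg, c, a, h⟩
      obtain ⟨d, b, h', -⟩ := h.exists_top_of_two hC
      exact ⟨hg, d, b, h'⟩
    · rintro ⟨hg, c, a, h⟩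
      exact ⟨hg, c, a, h.two_of_top⟩
  refine ⟨heq, fun g hg => ⟨?_, ?_⟩⟩
  · refine le_of_forall_pos_le_add fun ε hε => ?_
    rw [heq] at hg
    obtain ⟨c, a, h, hlt⟩ := exists_isDecomp_lt hg.2 hε
    exact h.two_of_top.hardyNorm_le.trans hlt.le
  · refine le_of_forall_pos_le_add fun ε hε => ?_
    obtain ⟨c, a, h, hlt⟩ := exists_isDecomp_lt hg.2 (div_pos hε hC0)
    obtain ⟨d, b, h', hle⟩ := h.exists_top_of_two hC
    refine h'.hardyNorm_le.trans (hle.trans ((mul_le_mul_of_nonneg_left hlt.le hC0.le).trans ?_))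
    rw [mul_add, mul_div_cancel₀ _ hC0.ne']

end Atoms

end WeightedTree

namespace WeightedTree

/-! ### Finite combinations of atoms and their density in H¹. -/

section FiniteCombinations

variable {V : Type*} {m : ℕ} [MeasurableSpace V] [DiscreteMeasurableSpace V] {T : WeightedTree V m}

lemma integral_mul_eq_sum (f : V → ℂ) {a : V → ℂ} {B : Finset V} (hs : ∀ x, x ∉ B → a x = 0)
    (h0 : ∑ x ∈ B, (T.weight x : ℂ) * a x = 0) (c : ℂ) :
    ∫ x, f x * a x ∂T.μ = ∑ x ∈ B, (T.weight x : ℂ) * ((f x - c) * a x) := by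
  rw [T.integral_eq_sum (B := B) fun x hx => by rw [hs x hx, mul_zero]]
  have : ∑ x ∈ B, (T.weight x : ℂ) * ((f x - c) * a x) =
      ∑ x ∈ B, (T.weight x : ℂ) * (f x * a x) - c * ∑ x ∈ B, (T.weight x : ℂ) * a x := by
    rw [Finset.mul_sum, ← Finset.sum_sub_distrib]
    exact Finset.sum_congr rfl fun x _ => by ring
  rw [this, h0, mul_zero, sub_zero]

/-- Bounded functions of mean zero on a Calderón–Zygmund set are multiples of atoms. -/
lemma exists_atom_top_eq_smul {h : V → ℂ} {B : Finset V} (hB : T.IsCZ (B : Set V))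
    (hpos : 0 < ∑ x ∈ B, T.weight x) (hs : ∀ x, x ∉ B → h x = 0)
    (h0 : ∑ x ∈ B, (T.weight x : ℂ) * h x = 0) {M : ℝ} (hM : 0 < M) (hle : ∀ x, ‖h x‖ ≤ M) :
    ∃ a, T.IsAtom ∞ a ∧ h = ((M * ∑ x ∈ B, T.weight x : ℝ) : ℂ) • a := by
  set k : ℝ := M * ∑ x ∈ B, T.weight x with hk
  have hk0 : 0 < k := mul_pos hM hpos
  have hk0' : (k : ℂ) ≠ 0 := by exact_mod_cast hk0.ne'
  refine ⟨(k : ℂ)⁻¹ • h, isAtom_top_iff.2 ⟨B, hB, hpos, ?_, ?_, ?_⟩, (smul_inv_smul₀ hk0' h).symm⟩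
  · intro x hx
    simp [hs x hx]
  · intro x
    rw [Pi.smul_apply, norm_smul, norm_inv, Complex.norm_real, Real.norm_of_nonneg hk0.le,
      mul_assoc, inv_mul_le_iff₀ hk0, mul_one, hk]
    exact mul_le_mul_of_nonneg_right (hle x) hpos.le
  · have : ∀ x, (T.weight x : ℂ) * ((k : ℂ)⁻¹ • h) x = (k : ℂ)⁻¹ * ((T.weight x : ℂ) * h x) :=
      fun x => by simp only [Pi.smul_apply, smul_eq_mul]; ring
    simp only [this, ← Finset.mul_sum, h0, mul_zero]

lemma mem_hardyFin {h : V → ℂ} {B : Finset V} (hB : T.IsCZ (B : Set V))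
    (hs : ∀ x, x ∉ B → h x = 0) (h0 : ∑ x ∈ B, (T.weight x : ℂ) * h x = 0) :
    h ∈ T.hardyFin := by
  obtain ⟨B', hB', hpos⟩ := hB.exists_finset
  rw [Finset.coe_inj] at hB'
  subst hB'
  have hnn : 0 ≤ ∑ x ∈ B, ‖h x‖ := Finset.sum_nonneg fun _ _ => norm_nonneg _
  obtain ⟨a, ha, e⟩ := exists_atom_top_eq_smul hB hpos hs h0
    -- The added 1 keeps the bound positive when `h` vanishes.
    (M := ∑ x ∈ B, ‖h x‖ + 1) (by positivity) (fun x => by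
      by_cases hx : x ∈ B
      · linarith [Finset.single_le_sum (f := fun x => ‖h x‖) (fun _ _ => norm_nonneg _) hx]
      · rw [hs x hx, norm_zero]
        positivity)
  rw [e]
  exact Submodule.smul_mem _ _ (Submodule.subset_span ha)

lemma exists_support_of_mem_hardyFin {g : V → ℂ} (hg : g ∈ T.hardyFin) : ∃ B : Finset V,
    (∀ x, x ∉ B → g x = 0) ∧ ∑ x ∈ B, (T.weight x : ℂ) * g x = 0 := by
  classical
  induction hg using Submodule.span_induction with
  | mem a ha =>
    obtain ⟨B, -, -, hs, -, h0⟩ := isAtom_top_iff.1 ha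
    exact ⟨B, hs, h0⟩
  | zero => exact ⟨∅, by simp⟩
  | add f g _ _ hf hg =>
    obtain ⟨B, hs, h0⟩ := hf
    obtain ⟨B', hs', h0'⟩ := hg
    refine ⟨B ∪ B', fun x hx => ?_, ?_⟩
    · rw [Finset.mem_union, not_or] at hx
      simp [hs x hx.1, hs' x hx.2]
    · simp only [Pi.add_apply, mul_add, Finset.sum_add_distrib]
      rw [← Finset.sum_subset Finset.subset_union_left fun x _ hx => by rw [hs x hx, mul_zero],
        ← Finset.sum_subset Finset.subset_union_right fun x _ hx => by rw [hs' x hx, mul_zero],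
        h0, h0', add_zero]
  | smul k g _ hg =>
    obtain ⟨B, hs, h0⟩ := hg
    refine ⟨B, fun x hx => by simp [hs x hx], ?_⟩
    simp only [Pi.smul_apply, smul_eq_mul, mul_left_comm _ k, ← Finset.mul_sum, h0, mul_zero]

lemma finToHardy_sum {ι : Type*} (s : Finset ι) (g : ι → T.hardyFin) :
    T.finToHardy (∑ i ∈ s, g i) = ∑ i ∈ s, T.finToHardy (g i) := by
  classical
  induction s using Finset.induction_on with
  | empty => rfl
  | insert i s hi ih =>
    rw [Finset.sum_insert hi, Finset.sum_insert hi, ← ih]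
    rfl

lemma finToHardy_smul (k : ℂ) (g : T.hardyFin) : T.finToHardy (k • g) = k • T.finToHardy g := rfl

lemma norm_finToHardy (g : T.hardyFin) : ‖T.finToHardy g‖ = T.hardyNorm ∞ g.1 := rfl

/-- The finite linear combinations of atoms are dense in `H¹`. -/
lemma exists_tendsto_finToHardy (g : T.HardySpace) :
    ∃ u : ℕ → T.hardyFin, Tendsto (fun n => T.finToHardy (u n)) atTop (𝓝 g) := by
  obtain ⟨c, a, h⟩ := g.2.2
  have h' := isDecomp_top_iff.1 h
  have hu : ∀ n, ∑ j ∈ Finset.range n, c j • a j ∈ T.hardyFin := fun n =>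
    Submodule.sum_mem _ fun j _ => Submodule.smul_mem _ _ (Submodule.subset_span (h'.1 j))
  refine ⟨fun n => ⟨_, hu n⟩, ?_⟩
  rw [tendsto_iff_norm_sub_tendsto_zero]
  refine squeeze_zero (fun _ => norm_nonneg _) (fun n => ?_)
    (tendsto_sum_nat_add fun j => ‖c j‖)
  rw [norm_sub_rev]
  -- The tail of a decomposition decomposes the remainder, so the H¹ norm of the remainder is at
  -- most the tail of the coefficients.
  have hd : T.IsDecomp ∞ (g.1 - ∑ j ∈ Finset.range n, c j • a j) (fun j => c (j + n))
      fun j => a (j + n) := by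
    refine isDecomp_top_iff.2 ⟨fun j => h'.1 _, (summable_nat_add_iff n).2 h'.2.1, fun x => ?_⟩
    have := (hasSum_nat_add_iff' n).2 (h'.2.2 x)
    simpa using this
  exact hd.hardyNorm_le

lemma ext_of_finToHardy {L L' : StrongDual ℂ T.HardySpace}
    (h : ∀ g : T.hardyFin, L (T.finToHardy g) = L' (T.finToHardy g)) : L = L' := by
  ext g
  obtain ⟨u, hu⟩ := exists_tendsto_finToHardy g
  have h1 := (L.continuous.tendsto g).comp hu
  have h2 := (L'.continuous.tendsto g).comp hu
  refine tendsto_nhds_unique h1 (h2.congr fun n => ?_)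
  exact (h (u n)).symm

end FiniteCombinations

/-! ### The BMO norm through finite sums, and independence of the representative. -/

section BMO

variable {V : Type*} {m : ℕ} [MeasurableSpace V] [DiscreteMeasurableSpace V] {T : WeightedTree V m}

lemma osc_le_norm (F : T.bmoSubmodule) {R : Set V} (hR : T.IsCZ R) :
    T.osc F.1 R ≤ ‖T.bmoMk F‖ := by
  rw [norm_bmoMk]
  exact le_ciSup F.2.2 ⟨R, hR⟩

lemma sum_osc_le_norm (F : T.bmoSubmodule) {B : Finset V} (hB : T.IsCZ (B : Set V))
    (hpos : 0 < ∑ x ∈ B, T.weight x) :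
    ∑ x ∈ B, T.weight x * ‖F.1 x - weightedAvg T.weight F.1 B‖ ≤
      ‖T.bmoMk F‖ * ∑ x ∈ B, T.weight x := by
  have h := osc_le_norm F hB
  rwa [osc_finset, inv_mul_le_iff₀ hpos, mul_comm] at h

lemma norm_bmoMk_nonneg (F : T.bmoSubmodule) : 0 ≤ ‖T.bmoMk F‖ := by
  obtain ⟨z⟩ := T.instNonemptyGeod
  refine le_trans ?_ (osc_le_norm F (T.isCZ_singleton (z : V)))
  rw [osc, setAverage_eq, smul_eq_mul]
  exact mul_nonneg (by positivity) (integral_nonneg fun _ => norm_nonneg _)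

lemma osc_le_of_sum_le {f : V → ℂ} {K : ℝ} (h : ∀ B : Finset V, T.IsCZ (B : Set V) →
      0 < ∑ x ∈ B, T.weight x → ∑ x ∈ B, T.weight x * ‖f x - weightedAvg T.weight f B‖ ≤
      K * ∑ x ∈ B, T.weight x) {R : Set V} (hR : T.IsCZ R) : T.osc f R ≤ K := by
  obtain ⟨B, rfl, hpos⟩ := hR.exists_finset
  rw [osc_finset, inv_mul_le_iff₀ hpos, mul_comm]
  exact h B hR hpos

lemma mem_bmoSubmodule {f : V → ℂ} {K : ℝ} (h : ∀ R, T.IsCZ R → T.osc f R ≤ K) :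
    f ∈ T.bmoSubmodule := by
  refine ⟨fun R hR => ?_, K, ?_⟩
  · obtain ⟨B, rfl, -⟩ := hR.exists_finset
    exact T.integrableOn_finset f B
  · rintro _ ⟨R, rfl⟩
    exact h R R.2

lemma norm_bmoMk_le {F : T.bmoSubmodule} {K : ℝ} (h : ∀ R, T.IsCZ R → T.osc F.1 R ≤ K) :
    ‖T.bmoMk F‖ ≤ K := by
  obtain ⟨z⟩ := T.instNonemptyGeod
  have : Nonempty {R : Set V // T.IsCZ R} := ⟨⟨_, T.isCZ_singleton (z : V)⟩⟩
  rw [norm_bmoMk]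
  exact ciSup_le fun R => h R R.2

lemma bmoMk_eq_iff {F G : T.bmoSubmodule} :
    T.bmoMk F = T.bmoMk G ↔ ∃ k : ℂ, ∀ x, F.1 x = G.1 x + k := by
  have h : T.bmoMk F = T.bmoMk G ↔ F - G ∈ T.bmoConst := Submodule.Quotient.eq _
  rw [h, bmoConst, Submodule.mem_comap, Submodule.mem_span_singleton]
  refine exists_congr fun k => ?_
  rw [funext_iff]
  refine forall_congr' fun x => ?_
  change k * 1 = F.1 x - G.1 x ↔ _
  rw [mul_one, eq_sub_iff_add_eq, add_comm, eq_comm]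

lemma bmoMk_surjective (f : T.BMO) : ∃ F, T.bmoMk F = f := Submodule.mkQ_surjective _ f

/-- It suffices to test the pairing on one representative. -/
lemma represents_bmoMk_iff {L : StrongDual ℂ T.HardySpace} {F : T.bmoSubmodule} :
    T.Represents L (T.bmoMk F) ↔
      ∀ g : T.hardyFin, L (T.finToHardy g) = ∫ x, F.1 x * g.1 x ∂T.μ := by
  refine ⟨fun h => h F rfl, fun h G hG g => ?_⟩
  obtain ⟨k, hk⟩ := bmoMk_eq_iff.1 hG
  obtain ⟨B, hs, h0⟩ := exists_support_of_mem_hardyFin g.2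
  rw [h g, integral_mul_eq_sum _ hs h0 0, integral_mul_eq_sum _ hs h0 k]
  refine Finset.sum_congr rfl fun x _ => ?_
  rw [hk x]
  ring

end BMO

/-! ### Truncation as a bounded 1-Lipschitz map. -/

section Truncation

/-- Truncation of the real and imaginary parts to `[-N, N]`. -/
def truncate (N : ℝ) (z : ℂ) : ℂ := ⟨max (-N) (min N z.re), max (-N) (min N z.im)⟩

lemma norm_truncate_sub_le (N : ℝ) (z w : ℂ) : ‖truncate N z - truncate N w‖ ≤ ‖z - w‖ := by
  have key : ∀ s t : ℝ, |max (-N) (min N s) - max (-N) (min N t)| ≤ |s - t| := by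
    intro s t
    have h1 := abs_max_sub_max_le_max (-N) (min N s) (-N) (min N t)
    have h2 := abs_min_sub_min_le_max N s N t
    simp only [sub_self, abs_zero] at h1 h2
    rw [max_eq_right (abs_nonneg (min N s - min N t))] at h1
    rw [max_eq_right (abs_nonneg (s - t))] at h2
    exact h1.trans h2
  refine le_of_sq_le_sq ?_ (norm_nonneg _)
  rw [Complex.sq_norm, Complex.sq_norm, Complex.normSq_apply, Complex.normSq_apply]
  have h1 := sq_le_sq.2 (key z.re w.re)
  have h2 := sq_le_sq.2 (key z.im w.im)
  simp only [Complex.sub_re, Complex.sub_im, truncate]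
  nlinarith

lemma norm_truncate_le {N : ℝ} (hN : 0 ≤ N) (z : ℂ) : ‖truncate N z‖ ≤ 2 * N := by
  have key : ∀ s : ℝ, |max (-N) (min N s)| ≤ N := fun s =>
    abs_le.2 ⟨le_max_left _ _, max_le (by linarith) (min_le_left _ _)⟩
  refine (Complex.norm_le_abs_re_add_abs_im _).trans ?_
  have h1 := key z.re
  have h2 := key z.im
  simp only [truncate]
  linarith

lemma truncate_eq_self {N : ℝ} {z : ℂ} (h : ‖z‖ ≤ N) : truncate N z = z := by
  have h1 := abs_le.1 ((Complex.abs_re_le_norm z).trans h)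
  have h2 := abs_le.1 ((Complex.abs_im_le_norm z).trans h)
  apply Complex.ext <;> simp [truncate, h1, h2]

end Truncation

/-! ### From BMO functions to functionals on H¹. -/

section Functional

variable {V : Type*} {m : ℕ} [MeasurableSpace V] [DiscreteMeasurableSpace V] {T : WeightedTree V m}

/-- The atom has mean zero, so any constant may be subtracted. Subtracting `φ` of the average of
`F`, rather than the average of `φ ∘ F`, avoids a factor 2. It is used for truncations and for the
identity. -/
lemma norm_integral_comp_mul_atom_le (F : T.bmoSubmodule) {φ : ℂ → ℂ}
    (hφ : ∀ z w, ‖φ z - φ w‖ ≤ ‖z - w‖) {a : V → ℂ} (ha : T.IsAtom ∞ a) :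
    ‖∫ x, φ (F.1 x) * a x ∂T.μ‖ ≤ ‖T.bmoMk F‖ := by
  obtain ⟨B, hB, hpos, hs, hn, h0⟩ := isAtom_top_iff.1 ha
  rw [integral_mul_eq_sum _ hs h0 (φ (weightedAvg T.weight F.1 B))]
  have h1 := sum_osc_le_norm F hB hpos
  refine (norm_sum_le _ _).trans ?_
  have h2 : ∀ x ∈ B, ‖(T.weight x : ℂ) * ((φ (F.1 x) - φ (weightedAvg T.weight F.1 B)) * a x)‖ ≤
      T.weight x * ‖F.1 x - weightedAvg T.weight F.1 B‖ * (∑ x ∈ B, T.weight x)⁻¹ := by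
    intro x _
    rw [norm_mul, norm_mul, Complex.norm_real, Real.norm_of_nonneg (T.weight_pos x).le, mul_assoc]
    refine mul_le_mul_of_nonneg_left ?_ (T.weight_pos x).le
    refine mul_le_mul (hφ _ _) ?_ (norm_nonneg _) (norm_nonneg _)
    rw [← one_div, le_div_iff₀ hpos]
    exact hn x
  refine (Finset.sum_le_sum h2).trans ?_
  rw [← Finset.sum_mul, ← div_eq_mul_inv, div_le_iff₀ hpos]
  exact h1

lemma IsAtom.integrable {a : V → ℂ} (ha : T.IsAtom ∞ a) : Integrable a T.μ :=
  memLp_one_iff_integrable.1 ⟨aesm _ _, ha.eLpNorm_one_le.trans_lt ENNReal.one_lt_top⟩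

lemma IsAtom.integral_norm_le {a : V → ℂ} (ha : T.IsAtom ∞ a) : ∫ x, ‖a x‖ ∂T.μ ≤ 1 := by
  rw [integral_norm_eq_lintegral_enorm (aesm _ _), ← eLpNorm_one_eq_lintegral_enorm]
  exact ENNReal.toReal_mono ENNReal.one_ne_top ha.eLpNorm_one_le

lemma integrable_truncate_mul (f : V → ℂ) {g : V → ℂ} (hg : Integrable g T.μ) (N : ℕ) :
    Integrable (fun x => truncate N (f x) * g x) T.μ :=
  hg.bdd_mul (c := 2 * N) (aesm _ _) (ae_of_all _ fun _ => norm_truncate_le N.cast_nonneg _)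

lemma eventually_integral_truncate_eq (f : V → ℂ) {g : V → ℂ} {B : Finset V}
    (hs : ∀ x, x ∉ B → g x = 0) :
    ∀ᶠ N : ℕ in atTop, ∫ x, truncate N (f x) * g x ∂T.μ = ∫ x, f x * g x ∂T.μ := by
  obtain ⟨N₀, hN₀⟩ := exists_nat_ge (∑ x ∈ B, ‖f x‖)
  refine (eventually_ge_atTop N₀).mono fun N hN => ?_
  congr 1
  ext x
  by_cases hx : x ∈ B
  · rw [truncate_eq_self]
    have h1 := Finset.single_le_sum (f := fun x => ‖f x‖) (fun _ _ => norm_nonneg _) hx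
    have h2 : (N₀ : ℝ) ≤ N := by exact_mod_cast hN
    exact h1.trans (hN₀.trans h2)
  · rw [hs x hx, mul_zero, mul_zero]

lemma hasSum_integral_truncate_mul (f : V → ℂ) {g : V → ℂ} {c : ℕ → ℂ} {a : ℕ → V → ℂ}
    (h : T.IsDecomp ∞ g c a) (N : ℕ) :
    HasSum (fun j => c j * ∫ x, truncate N (f x) * a j x ∂T.μ)
      (∫ x, truncate N (f x) * g x ∂T.μ) := by
  obtain ⟨ha, hc, hg⟩ := isDecomp_top_iff.1 h
  have hi : ∀ j, Integrable (fun x => c j * (truncate N (f x) * a j x)) T.μ := fun j =>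
    (integrable_truncate_mul f (ha j).integrable N).const_mul _
  have hs : Summable fun j => ∫ x, ‖c j * (truncate N (f x) * a j x)‖ ∂T.μ := by
    refine Summable.of_nonneg_of_le (fun j => integral_nonneg fun _ => norm_nonneg _) (fun j => ?_)
      (hc.mul_right (2 * (N : ℝ)))
    calc ∫ x, ‖c j * (truncate N (f x) * a j x)‖ ∂T.μ
        ≤ ∫ x, ‖c j‖ * (2 * N) * ‖a j x‖ ∂T.μ := by
          refine integral_mono (hi j).norm ((ha j).integrable.norm.const_mul _) fun x => ?_
          simp only [norm_mul, mul_assoc]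
          refine mul_le_mul_of_nonneg_left ?_ (norm_nonneg _)
          rw [← mul_assoc]
          exact mul_le_mul_of_nonneg_right (norm_truncate_le N.cast_nonneg _) (norm_nonneg _)
      _ ≤ ‖c j‖ * (2 * N) := by
          rw [integral_const_mul]
          exact mul_le_of_le_one_right (by positivity) (ha j).integral_norm_le
  have := hasSum_integral_of_summable_integral_norm hi hs
  simp only [integral_const_mul] at this
  have e : ∀ x, ∑' j, c j * (truncate N (f x) * a j x) = truncate N (f x) * g x := fun x => by
    rw [← ((hg x).mul_left (truncate N (f x))).tsum_eq]
    exact tsum_congr fun j => by ring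
  simpa only [e] using this

/-- The pairing of `H¹` with a function of bounded mean oscillation, as a limit of pairings with
bounded functions. -/
lemma exists_tendsto_integral_truncate_mul (F : T.bmoSubmodule) (g : T.HardySpace) :
    ∃ l : ℂ, Tendsto (fun N : ℕ => ∫ x, truncate N (F.1 x) * g.1 x ∂T.μ) atTop (𝓝 l) ∧
      ‖l‖ ≤ ‖T.bmoMk F‖ * ‖g‖ := by
  -- Dominated convergence for series lets the truncation go to infinity term by term. The truncated
  -- integrals depend on `g` alone, so all decompositions yield the same limit, and the bound may be
  -- taken along a nearly optimal one.
  have key : ∀ c a, T.IsDecomp ∞ g.1 c a →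
      Tendsto (fun N : ℕ => ∫ x, truncate N (F.1 x) * g.1 x ∂T.μ) atTop
        (𝓝 (∑' j, c j * ∫ x, F.1 x * a j x ∂T.μ)) ∧
      ‖∑' j, c j * ∫ x, F.1 x * a j x ∂T.μ‖ ≤ ‖T.bmoMk F‖ * ∑' j, ‖c j‖ := by
    intro c a h
    obtain ⟨ha, hc, hg⟩ := isDecomp_top_iff.1 h
    constructor
    · simp only [← (hasSum_integral_truncate_mul F.1 h _).tsum_eq]
      refine tendsto_tsum_of_dominated_convergence (hc.mul_right ‖T.bmoMk F‖) (fun j => ?_)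
        (Eventually.of_forall fun N j => ?_)
      · obtain ⟨B, -, -, hs, -, -⟩ := isAtom_top_iff.1 (ha j)
        refine Tendsto.const_mul _ (tendsto_const_nhds.congr' ?_)
        exact (eventually_integral_truncate_eq F.1 hs).mono fun N hN => hN.symm
      · rw [norm_mul]
        exact mul_le_mul_of_nonneg_left
          (norm_integral_comp_mul_atom_le F (norm_truncate_sub_le N) (ha j)) (norm_nonneg _)
    · rw [mul_comm]
      refine tsum_of_norm_bounded (hc.mul_right ‖T.bmoMk F‖).hasSum (fun j => ?_) |>.trans
        (le_of_eq tsum_mul_right)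
      rw [norm_mul]
      exact mul_le_mul_of_nonneg_left
        (norm_integral_comp_mul_atom_le F (φ := id) (fun _ _ => le_rfl) (ha j)) (norm_nonneg _)
  obtain ⟨c, a, h⟩ := g.2.2
  refine ⟨_, (key c a h).1, ?_⟩
  have hF := norm_bmoMk_nonneg F
  refine le_of_forall_pos_le_add fun ε hε => ?_
  obtain ⟨c', a', h', hlt⟩ := exists_isDecomp_lt g.2.2
    (div_pos hε (by positivity : 0 < ‖T.bmoMk F‖ + 1))
  rw [tendsto_nhds_unique (key c a h).1 (key c' a' h').1]
  refine (key c' a' h').2.trans ((mul_le_mul_of_nonneg_left hlt.le hF).trans ?_)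
  rw [mul_add]
  refine add_le_add le_rfl ?_
  rw [mul_div_assoc', div_le_iff₀ (by positivity)]
  nlinarith

lemma exists_represents (f : T.BMO) :
    ∃ L : StrongDual ℂ T.HardySpace, T.Represents L f ∧ ‖L‖ ≤ ‖f‖ := by
  obtain ⟨F, rfl⟩ := bmoMk_surjective f
  choose l hl hle using exists_tendsto_integral_truncate_mul F
  have hi : ∀ g : T.HardySpace, Integrable g.1 T.μ := fun g => memLp_one_iff_integrable.1 g.2.1
  let L₀ : T.HardySpace →ₗ[ℂ] ℂ :=
    { toFun := l
      map_add' := fun g h => by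
        refine tendsto_nhds_unique (hl (g + h)) (((hl g).add (hl h)).congr fun N => ?_)
        rw [← integral_add (integrable_truncate_mul F.1 (hi g) N)
          (integrable_truncate_mul F.1 (hi h) N)]
        congr 1
        ext x
        exact (mul_add _ _ _).symm
      map_smul' := fun k g => by
        refine tendsto_nhds_unique (hl (k • g)) (((hl g).const_mul k).congr fun N => ?_)
        rw [← integral_const_mul]
        congr 1
        ext x
        exact mul_left_comm _ _ _ }
  refine ⟨L₀.mkContinuous _ hle, represents_bmoMk_iff.2 fun g => ?_,
    L₀.mkContinuous_norm_le (norm_bmoMk_nonneg F) hle⟩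
  obtain ⟨B, hs, -⟩ := exists_support_of_mem_hardyFin g.2
  refine tendsto_nhds_unique (hl (T.finToHardy g)) (tendsto_const_nhds.congr' ?_)
  exact (eventually_integral_truncate_eq F.1 hs).mono fun N hN => hN.symm

end Functional

end WeightedTree

namespace WeightedTree

/-! ### From functionals to BMO functions, and the comparison of H^{1,2} with H^{1,∞}. -/

section Duality

variable {V : Type*} {m : ℕ} [MeasurableSpace V] [DiscreteMeasurableSpace V] {T : WeightedTree V m}

open Classical in
/-- The difference of the normalized point masses at `x` and at `o`. -/
def dipole (T : WeightedTree V m) (o x : V) : V → ℂ :=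
  Pi.single x ((T.weight x : ℂ)⁻¹) - Pi.single o ((T.weight o : ℂ)⁻¹)

lemma ofReal_weight_ne_zero (x : V) : (T.weight x : ℂ) ≠ 0 := by
  exact_mod_cast (T.weight_pos x).ne'

lemma sum_weight_mul_dipole (o x : V) {B : Finset V} (hx : x ∈ B) (ho : o ∈ B) (f : V → ℂ) :
    ∑ y ∈ B, (T.weight y : ℂ) * (f y * T.dipole o x y) = f x - f o := by
  classical
  have e : ∀ z ∈ B, ∑ y ∈ B,
      (T.weight y : ℂ) * (f y * (Pi.single z ((T.weight z : ℂ)⁻¹) : V → ℂ) y) = f z := by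
    intro z hz
    rw [Finset.sum_eq_single_of_mem z hz fun y _ hy => by simp [hy], Pi.single_eq_same,
      mul_left_comm, mul_inv_cancel₀ (ofReal_weight_ne_zero z), mul_one]
  simp only [dipole, Pi.sub_apply, mul_sub, Finset.sum_sub_distrib]
  rw [← e x hx, ← e o ho]

lemma dipole_apply_of_ne {o x y : V} (hx : y ≠ x) (ho : y ≠ o) : T.dipole o x y = 0 := by
  simp [dipole, hx, ho]

lemma dipole_mem_hardyFin (o x : V) : T.dipole o x ∈ T.hardyFin := by
  obtain ⟨R, hR, hx, ho⟩ := T.exists_isCZ_pair x o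
  obtain ⟨B, rfl, -⟩ := hR.exists_finset
  refine mem_hardyFin hR (fun y hy => dipole_apply_of_ne ?_ ?_) ?_
  · rintro rfl
    exact hy hx
  · rintro rfl
    exact hy ho
  · simpa using T.sum_weight_mul_dipole o x hx ho fun _ => 1

lemma sum_smul_dipole (o : V) {g : V → ℂ} {B : Finset V} (hs : ∀ x, x ∉ B → g x = 0)
    (h0 : ∑ x ∈ B, (T.weight x : ℂ) * g x = 0) :
    ∑ x ∈ B, ((T.weight x : ℂ) * g x) • T.dipole o x = g := by
  classical
  simp only [dipole, smul_sub, Finset.sum_sub_distrib]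
  rw [← Finset.sum_smul, h0, zero_smul, sub_zero]
  ext y
  simp only [Finset.sum_apply, Pi.smul_apply, smul_eq_mul]
  by_cases hy : y ∈ B
  · rw [Finset.sum_eq_single_of_mem y hy fun x _ hx => by simp [hx.symm], Pi.single_eq_same,
      mul_right_comm, mul_inv_cancel₀ (ofReal_weight_ne_zero y), one_mul]
  · rw [hs y hy]
    refine Finset.sum_eq_zero fun x hx => ?_
    have : y ≠ x := fun h => hy (h ▸ hx)
    simp [this]

/-- Bounded functionals on `H¹` are given on finite combinations of atoms by functions. -/
lemma exists_function (L : StrongDual ℂ T.HardySpace) : ∃ f : V → ℂ,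
    ∀ g : T.hardyFin, L (T.finToHardy g) = ∫ x, f x * g.1 x ∂T.μ := by
  obtain ⟨⟨o, -⟩⟩ := T.instNonemptyGeod
  -- The representing function is only determined up to a constant; this choice vanishes at `o`.
  refine ⟨fun x => L (T.finToHardy ⟨T.dipole o x, dipole_mem_hardyFin o x⟩), fun g => ?_⟩
  obtain ⟨B, hs, h0⟩ := exists_support_of_mem_hardyFin g.2
  have hg : g = ∑ x ∈ B, ((T.weight x : ℂ) * g.1 x) •
      (⟨T.dipole o x, dipole_mem_hardyFin o x⟩ : T.hardyFin) := by
    refine Subtype.ext ?_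
    rw [AddSubmonoidClass.coe_finsetSum]
    exact (sum_smul_dipole o hs h0).symm
  conv_lhs => rw [hg]
  rw [finToHardy_sum, map_sum, T.integral_eq_sum (B := B) fun x hx => by rw [hs x hx, mul_zero]]
  refine Finset.sum_congr rfl fun x _ => ?_
  rw [finToHardy_smul, map_smul, smul_eq_mul]
  ring

lemma norm_apply_le (L : StrongDual ℂ T.HardySpace) (g : T.hardyFin) :
    ‖L (T.finToHardy g)‖ ≤ ‖L‖ * T.hardyNorm ∞ g.1 := L.le_opNorm _

/-- The function representing a bounded functional has bounded mean oscillation. -/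
lemma sum_osc_le_two_mul {L : StrongDual ℂ T.HardySpace} {f : V → ℂ}
    (hf : ∀ g : T.hardyFin, L (T.finToHardy g) = ∫ x, f x * g.1 x ∂T.μ) {B : Finset V}
    (hB : T.IsCZ (B : Set V)) (hpos : 0 < ∑ x ∈ B, T.weight x) :
    ∑ x ∈ B, T.weight x * ‖f x - weightedAvg T.weight f B‖ ≤
      2 * ‖L‖ * ∑ x ∈ B, T.weight x := by
  classical
  have hw : ∀ x, 0 ≤ T.weight x := fun x => (T.weight_pos x).le
  set k := weightedAvg T.weight f B
  -- The conjugate phase of `f - k`; where `f x = k` the quotient is 0 by convention, which is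
  -- harmless.
  set u : V → ℂ := fun x => (starRingEnd ℂ) (f x - k) / ‖f x - k‖
  have hu : ∀ x, ‖u x‖ ≤ 1 := fun x => by
    simp only [u, norm_div, RCLike.norm_conj, Complex.norm_real, norm_norm]
    exact div_self_le_one _
  have hfu : ∀ x, (f x - k) * u x = (‖f x - k‖ : ℂ) := fun x => by
    simp only [u]
    rw [← mul_div_assoc, Complex.mul_conj, Complex.normSq_eq_norm_sq]
    by_cases h : ‖f x - k‖ = 0
    · simp [h]
    · have h' : (‖f x - k‖ : ℂ) ≠ 0 := by exact_mod_cast h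
      push_cast
      field_simp
  set l := weightedAvg T.weight u B
  have hl : ‖l‖ ≤ 1 := by
    have h1 := norm_weightedAvg_sub_le hw u hpos 0
    simp only [sub_zero] at h1
    have h2 : ∑ x ∈ B, T.weight x * ‖u x‖ ≤ ∑ x ∈ B, T.weight x :=
      Finset.sum_le_sum fun x _ => mul_le_of_le_one_right (hw x) (hu x)
    exact le_of_mul_le_mul_left ((h1.trans h2).trans (mul_one _).ge) hpos
  set h : V → ℂ := fun x => if x ∈ B then u x - l else 0
  have hs : ∀ x, x ∉ B → h x = 0 := fun x hx => if_neg hx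
  have hB' : ∀ x ∈ B, h x = u x - l := fun x hx => if_pos hx
  have h0 : ∑ x ∈ B, (T.weight x : ℂ) * h x = 0 := by
    rw [← sum_weight_mul_sub_weightedAvg u hpos]
    exact Finset.sum_congr rfl fun x hx => by rw [hB' x hx]
  obtain ⟨a, ha, e⟩ := exists_atom_top_eq_smul hB hpos hs h0 two_pos fun x => by
    by_cases hx : x ∈ B
    · rw [hB' x hx]
      exact (norm_sub_le _ _).trans (by linarith [hu x])
    · rw [hs x hx, norm_zero]
      exact two_pos.le
  have h1 := norm_apply_le L ⟨h, mem_hardyFin hB hs h0⟩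
  rw [hf, integral_mul_eq_sum f hs h0 k] at h1
  have h2 : ∑ x ∈ B, (T.weight x : ℂ) * ((f x - k) * h x) =
      ((∑ x ∈ B, T.weight x * ‖f x - k‖ : ℝ) : ℂ) := by
    have h3 : ∀ x ∈ B, (T.weight x : ℂ) * ((f x - k) * h x) =
        ((T.weight x * ‖f x - k‖ : ℝ) : ℂ) - (T.weight x : ℂ) * (f x - k) * l := by
      intro x hx
      rw [hB' x hx, mul_sub, hfu]
      push_cast
      ring
    rw [Finset.sum_congr rfl h3, Finset.sum_sub_distrib, ← Finset.sum_mul,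
      sum_weight_mul_sub_weightedAvg f hpos, zero_mul, sub_zero, Complex.ofReal_sum]
  rw [h2, Complex.norm_real] at h1
  have h4 : T.hardyNorm ∞ h ≤ 2 * ∑ x ∈ B, T.weight x := by
    rw [e]
    refine (hardyNorm_smul_atom_le ha _).trans (le_of_eq ?_)
    rw [Complex.norm_real, Real.norm_of_nonneg (by positivity)]
  calc _ ≤ _ := Real.le_norm_self _
    _ ≤ _ := h1
    _ ≤ ‖L‖ * (2 * ∑ x ∈ B, T.weight x) := mul_le_mul_of_nonneg_left h4 (norm_nonneg _)
    _ = _ := by ring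

/-- Each `(1, 2)`-atom belongs to `H¹`, with a uniform bound on its norm. -/
lemma IsAtom.hardyNorm_top_le {a : V → ℂ} (ha : T.IsAtom 2 a) :
    a ∈ T.hardyFin ∧ T.hardyNorm ∞ a ≤ √(48 * (7 * m * (2 * (2 * (7 * m)))) ^ 2) := by
  obtain ⟨B, hB, hpos, hs, hn, h0⟩ := isAtom_two_iff.1 ha
  have hmem := mem_hardyFin hB hs h0
  refine ⟨hmem, ?_⟩
  -- Hahn–Banach: a functional of norm at most 1 attaining the norm of the atom, so the norm becomes
  -- a pairing with a function of mean oscillation at most 2.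
  obtain ⟨L, hL, hLa⟩ := exists_dual_vector'' ℂ (T.finToHardy ⟨a, hmem⟩)
  obtain ⟨f, hf⟩ := exists_function L
  have hosc := T.sum_sq_osc_le f two_pos (fun R hR => by
    obtain ⟨R', e, hpos'⟩ := hR.exists_finset
    rw [Finset.coe_inj] at e
    subst e
    exact (sum_osc_le_two_mul hf hR hpos').trans
      (mul_le_mul_of_nonneg_right (by linarith) hpos'.le)) hB
  set C : ℝ := 48 * (7 * m * (2 * (2 * (7 * m)))) ^ 2
  have h1 : T.hardyNorm ∞ a ≤
      ∑ x ∈ B, T.weight x * (‖f x - weightedAvg T.weight f B‖ * ‖a x‖) := by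
    have h2 := congrArg norm hLa
    rw [hf, integral_mul_eq_sum f hs h0 (weightedAvg T.weight f B), RCLike.norm_ofReal,
      abs_norm, norm_finToHardy] at h2
    rw [← h2]
    refine (norm_sum_le _ _).trans (Finset.sum_le_sum fun x _ => ?_)
    rw [norm_mul, norm_mul, Complex.norm_real, Real.norm_of_nonneg (T.weight_pos x).le]
  refine Real.le_sqrt_of_sq_le ((pow_le_pow_left₀ (hardyNorm_nonneg _ _) h1 2).trans
    ((sq_sum_weight_mul_le B _ _).trans ?_))
  have h3 : 0 ≤ ∑ x ∈ B, T.weight x * ‖a x‖ ^ 2 :=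
    Finset.sum_nonneg fun x _ => mul_nonneg (T.weight_pos x).le (sq_nonneg _)
  calc _ ≤ C * (∑ x ∈ B, T.weight x) * ∑ x ∈ B, T.weight x * ‖a x‖ ^ 2 :=
        mul_le_mul_of_nonneg_right hosc h3
    _ = C * ((∑ x ∈ B, T.weight x * ‖a x‖ ^ 2) * ∑ x ∈ B, T.weight x) := by ring
    _ ≤ C := mul_le_of_le_one_right (by positivity) hn

variable (T) in
lemma exists_pos_isComparisonConst : ∃ C : ℝ, 0 < C ∧ T.IsComparisonConst 2 C := by
  -- The added 1 allows for the infimum defining the norm not being attained, and makes the constant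
  -- positive.
  refine ⟨√(48 * (7 * m * (2 * (2 * (7 * m)))) ^ 2) + 1, by positivity,
    exists_isComparisonConst (fun a ha => ?_) (by positivity)⟩
  obtain ⟨hmem, hle⟩ := ha.hardyNorm_top_le
  obtain ⟨d, b, h, hlt⟩ := exists_isDecomp_lt (hardyFin_le hmem).2 one_pos
  exact ⟨d, b, h, by linarith⟩

/-- The sign of `C` is not part of the definition; a negative `C` would force every H¹ norm to
vanish, hence `L = 0`. -/
lemma IsComparisonConst.mul_norm_nonneg {C : ℝ} (hC : T.IsComparisonConst 2 C)
    (L : StrongDual ℂ T.HardySpace) : 0 ≤ C * ‖L‖ := by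
  rcases le_or_gt 0 C with h | h
  · exact mul_nonneg h (norm_nonneg _)
  · have : L = 0 := by
      ext g
      have h1 : ‖g‖ ≤ C * T.hardyNorm 2 g.1 := (hC.2 g.1 (by rw [hC.1]; exact g.2)).2
      have h2 : ‖g‖ ≤ 0 :=
        h1.trans (mul_nonpos_of_nonpos_of_nonneg h.le (hardyNorm_nonneg _ _))
      rw [norm_le_zero_iff.1 h2, map_zero, map_zero]
    rw [this, norm_zero, mul_zero]

lemma hardyNorm_two_le {h : V → ℂ} {B : Finset V} (hB : T.IsCZ (B : Set V))
    (hpos : 0 < ∑ x ∈ B, T.weight x) (hs : ∀ x, x ∉ B → h x = 0)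
    (h0 : ∑ x ∈ B, (T.weight x : ℂ) * h x = 0) (hS : 0 < ∑ x ∈ B, T.weight x * ‖h x‖ ^ 2) :
    T.hardyNorm 2 h ≤ √((∑ x ∈ B, T.weight x * ‖h x‖ ^ 2) * ∑ x ∈ B, T.weight x) := by
  set S := ∑ x ∈ B, T.weight x * ‖h x‖ ^ 2 with hSdef
  set k := √(S * ∑ x ∈ B, T.weight x)
  have hk : 0 < k := Real.sqrt_pos.2 (mul_pos hS hpos)
  have hk' : (k : ℂ) ≠ 0 := by exact_mod_cast hk.ne'
  have hk2 : k ^ 2 = S * ∑ x ∈ B, T.weight x := Real.sq_sqrt (mul_pos hS hpos).le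
  have ha : T.IsAtom 2 ((k : ℂ)⁻¹ • h) := by
    refine isAtom_two_iff.2 ⟨B, hB, hpos, fun x hx => by simp [hs x hx], ?_, ?_⟩
    · have : ∀ x, T.weight x * ‖((k : ℂ)⁻¹ • h) x‖ ^ 2 = (k ^ 2)⁻¹ * (T.weight x * ‖h x‖ ^ 2) := by
        intro x
        rw [Pi.smul_apply, norm_smul, norm_inv, Complex.norm_real, Real.norm_of_nonneg hk.le]
        ring
      simp only [this]
      rw [← Finset.mul_sum, ← hSdef, mul_assoc, ← hk2, inv_mul_cancel₀ (by positivity)]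
    · have : ∀ x, (T.weight x : ℂ) * ((k : ℂ)⁻¹ • h) x = (k : ℂ)⁻¹ * ((T.weight x : ℂ) * h x) :=
        fun x => by simp only [Pi.smul_apply, smul_eq_mul]; ring
      simp only [this, ← Finset.mul_sum, h0, mul_zero]
  have h1 := hardyNorm_smul_atom_le ha (k : ℂ)
  rwa [smul_inv_smul₀ hk', Complex.norm_real, Real.norm_of_nonneg hk.le] at h1

/-- A comparison constant for `H^{1,2}` and `H^{1,∞}` bounds the mean oscillation of the function
representing a functional. -/
lemma IsComparisonConst.sum_osc_le {C : ℝ} (hC : T.IsComparisonConst 2 C)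
    {L : StrongDual ℂ T.HardySpace} {f : V → ℂ}
    (hf : ∀ g : T.hardyFin, L (T.finToHardy g) = ∫ x, f x * g.1 x ∂T.μ) {B : Finset V}
    (hB : T.IsCZ (B : Set V)) (hpos : 0 < ∑ x ∈ B, T.weight x) :
    ∑ x ∈ B, T.weight x * ‖f x - weightedAvg T.weight f B‖ ≤
      C * ‖L‖ * ∑ x ∈ B, T.weight x := by
  classical
  have hw : ∀ x, 0 ≤ T.weight x := fun x => (T.weight_pos x).le
  have hCL := hC.mul_norm_nonneg L
  set k := weightedAvg T.weight f B
  set W := ∑ x ∈ B, T.weight x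
  -- The pairing of `f` with this function is the square oscillation `S`, while its H^{1,2} norm is
  -- at most `√(S * W)`.
  set h : V → ℂ := fun x => if x ∈ B then (starRingEnd ℂ) (f x - k) else 0
  have hs : ∀ x, x ∉ B → h x = 0 := fun x hx => if_neg hx
  have hB' : ∀ x ∈ B, h x = (starRingEnd ℂ) (f x - k) := fun x hx => if_pos hx
  have h0 : ∑ x ∈ B, (T.weight x : ℂ) * h x = 0 := by
    have h1 := congrArg (starRingEnd ℂ) (sum_weight_mul_sub_weightedAvg f hpos)
    rw [map_sum, map_zero] at h1
    rw [← h1]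
    exact Finset.sum_congr rfl fun x hx => by rw [hB' x hx, map_mul, Complex.conj_ofReal]
  set S := ∑ x ∈ B, T.weight x * ‖f x - k‖ ^ 2
  have hS : ∑ x ∈ B, T.weight x * ‖h x‖ ^ 2 = S :=
    Finset.sum_congr rfl fun x hx => by rw [hB' x hx, RCLike.norm_conj]
  have hS0 : 0 ≤ S := Finset.sum_nonneg fun x _ => mul_nonneg (hw x) (sq_nonneg _)
  have hcs : (∑ x ∈ B, T.weight x * ‖f x - k‖) ^ 2 ≤ S * W := by
    have := sq_sum_weight_mul_le (T := T) B (fun x => ‖f x - k‖) fun _ => 1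
    simpa using this
  have hSle : S ≤ (C * ‖L‖) ^ 2 * W := by
    rcases hS0.eq_or_lt with hz | hp
    · rw [← hz]
      positivity
    · have hmem := mem_hardyFin hB hs h0
      have h1 := norm_apply_le L ⟨h, hmem⟩
      have h2 : ∑ x ∈ B, (T.weight x : ℂ) * ((f x - k) * h x) = (S : ℂ) := by
        rw [Complex.ofReal_sum]
        refine Finset.sum_congr rfl fun x hx => ?_
        rw [hB' x hx, Complex.mul_conj, Complex.normSq_eq_norm_sq]
        push_cast
        rfl
      rw [hf, integral_mul_eq_sum f hs h0 k, h2, Complex.norm_real, Real.norm_of_nonneg hS0] at h1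
      have h3 := (hC.2 h (by rw [hC.1]; exact hardyFin_le hmem)).2
      have h4 := hardyNorm_two_le hB hpos hs h0 (hS.symm ▸ hp)
      rw [hS] at h4
      have h5 : S ≤ C * ‖L‖ * √(S * W) := calc
        S ≤ ‖L‖ * (C * T.hardyNorm 2 h) := h1.trans (mul_le_mul_of_nonneg_left h3 (norm_nonneg _))
        _ = C * ‖L‖ * T.hardyNorm 2 h := by ring
        _ ≤ _ := mul_le_mul_of_nonneg_left h4 hCL
      have h6 := pow_le_pow_left₀ hS0 h5 2
      -- Squaring gives `S ^ 2 ≤ (C * ‖L‖) ^ 2 * (S * W)`, and one factor `S > 0` cancels.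
      rw [mul_pow, Real.sq_sqrt (by positivity)] at h6
      nlinarith
  -- Cauchy–Schwarz returns from square oscillation to mean oscillation without loss, so the
  -- constant stays exactly `C * ‖L‖`.
  refine le_of_sq_le_sq (hcs.trans ?_) (by positivity)
  nlinarith

lemma IsComparisonConst.exists_represents {C : ℝ} (hC : T.IsComparisonConst 2 C)
    (L : StrongDual ℂ T.HardySpace) : ∃ f : T.BMO, T.Represents L f ∧ ‖f‖ ≤ C * ‖L‖ := by
  obtain ⟨f, hf⟩ := exists_function L
  have hosc : ∀ R, T.IsCZ R → T.osc f R ≤ C * ‖L‖ := fun R hR =>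
    osc_le_of_sum_le (fun B hB hpos => hC.sum_osc_le hf hB hpos) hR
  exact ⟨T.bmoMk ⟨f, mem_bmoSubmodule hosc⟩, represents_bmoMk_iff.2 hf, norm_bmoMk_le hosc⟩

/-- Testing on dipoles recovers the differences `F x - F o`, hence the function modulo constants. -/
lemma Represents.unique {L : StrongDual ℂ T.HardySpace} {f f' : T.BMO} (h : T.Represents L f)
    (h' : T.Represents L f') : f' = f := by
  obtain ⟨F, rfl⟩ := bmoMk_surjective f
  obtain ⟨F', rfl⟩ := bmoMk_surjective f'
  rw [represents_bmoMk_iff] at h h'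
  obtain ⟨⟨o, -⟩⟩ := T.instNonemptyGeod
  refine bmoMk_eq_iff.2 ⟨F'.1 o - F.1 o, fun x => ?_⟩
  have key : ∀ G : V → ℂ, ∫ y, G y * T.dipole o x y ∂T.μ = G x - G o := by
    classical
    intro G
    rw [T.integral_eq_sum (B := {x, o}) fun y hy => ?_,
      sum_weight_mul_dipole o x (by simp) (by simp)]
    simp only [Finset.mem_insert, Finset.mem_singleton, not_or] at hy
    rw [dipole_apply_of_ne hy.1 hy.2, mul_zero]
  have e := (h ⟨_, dipole_mem_hardyFin o x⟩).symm.trans (h' ⟨_, dipole_mem_hardyFin o x⟩)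
  rw [key, key] at e
  linear_combination -e

end Duality

end WeightedTree

end

theorem theorem3 {V : Type*} [MeasurableSpace V] [DiscreteMeasurableSpace V] {m : ℕ}
    (T : WeightedTree V m) :
    (∃ A : ℝ, 0 < A ∧ ∀ f : T.BMO, ∃ L : StrongDual ℂ T.HardySpace,
      T.Represents L f ∧ ‖L‖ ≤ A * ‖f‖ ∧
        ∀ L' : StrongDual ℂ T.HardySpace, T.Represents L' f → L' = L) ∧
    (∃ C₂ : ℝ, 0 < C₂ ∧ T.IsComparisonConst 2 C₂) ∧
    (∀ C₂ : ℝ, T.IsComparisonConst 2 C₂ → ∀ L : StrongDual ℂ T.HardySpace,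
      ∃ f : T.BMO, T.Represents L f ∧ ‖f‖ ≤ C₂ * ‖L‖ ∧
        ∀ f' : T.BMO, T.Represents L f' → f' = f) := by
  refine ⟨⟨1, one_pos, fun f => ?_⟩, T.exists_pos_isComparisonConst, fun C₂ hC L => ?_⟩
  · obtain ⟨L, hL, hle⟩ := WeightedTree.exists_represents f
    refine ⟨L, hL, by rwa [one_mul], fun L' hL' => WeightedTree.ext_of_finToHardy fun g => ?_⟩
    obtain ⟨F, rfl⟩ := WeightedTree.bmoMk_surjective f
    rw [hL' F rfl g, hL F rfl g]
  · obtain ⟨f, hf, hle⟩ := hC.exists_represents L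
    exact ⟨f, hf, hle, fun f' hf' => hf.unique hf'⟩
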